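/- **Setting.** Let $x\in\mathbb R^d$ ($d\ge 1$) be a random vector with positive definite second-moment matrix $\Sigma=\mathbb E\,xx^\top$ (not necessarily centered) that is sub-Gaussian with parameter $K$, i.e. $\|\langle v,x\rangle\|_{\psi_2}\le K\,(v^\top\Sigma v)^{1/2}$ for all $v$, where $\|X\|_{\psi_2}=\inf\{t>0:\mathbb E e^{X^2/t^2}\le 2\}$. A sample is $(x,y)$ with $y=x^\top\beta+\varepsilon$ and $\varepsilon\sim\mathcal N(0,\sigma^2)$ independent of $x$ ($\sigma\ge 0$). The private data $(\mathbf A,\mathbf y_A)$ and the public data $(\mathbf B,\mathbf y_B)$ consist of $n_A$ and $n_B$ such samples, all independent, $n_A,n_B>d$. Put $\hat\Sigma_A=\mathbf A^\top\mathbf A/n_A$, $\hat\Sigma_B=\mathbf B^\top\mathbf B/n_B$, $\hat\sigma_B=(\|\mathbf y_B\|^2/n_B)^{1/2}$, $\hat\beta_A=\hat\Sigma_A^{-1}\mathbf A^\top\mathbf y_A/n_A$ and $\tilde\beta_A=\hat\sigma_B^{-1}\hat\Sigma_B^{1/2}\hat\beta_A$. Vector norms are Euclidean, matrix norms are operator norms.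 **Algorithm (DP-PMTOLSE).** Let $\rho>0$, $\eta\in(0,1)$ and let $\tau>0$ be a truncation constant. Replace each private feature vector $\mathbf A_i$ by $\hat\Sigma_B^{-1/2}\mathbf A_i$ and each response $y_{A_i}$ by $y_{A_i}/\hat\sigma_B$; then rescale each transformed feature vector of norm at least $\sqrt{\tau d(1+\log(2n_A/\eta))}$ to that norm, and each transformed response of absolute value at least $\sqrt{\tau(1+\log(2n_A/\eta))}$ to that absolute value. With the resulting data $\tilde{\mathbf A},\tilde{\mathbf y}_A$ set $$\tilde\beta_A^{DP}=\Big(\tfrac{\tilde{\mathbf A}^\top\tilde{\mathbf A}}{n_A}+\mathbf G\Big)^{-1}\Big(\tfrac{\tilde{\mathbf A}^\top\tilde{\mathbf y}_A}{n_A}+\mathbf g\Big),\qquad \hat\beta_A^{DP}=\hat\sigma_B\hat\Sigma_B^{-1/2}\tilde\beta_A^{DP},$$ where $\mathbf G$ is a symmetric random matrix whose entries on and above the diagonal are i.i.d. $\mathcal N(0,\sigma_1^2)$, $\mathbf g\sim\mathcal N(0,\sigma_2^2\mathbf I)$, $\mathbf G$ and $\mathbf g$ are independent of each other and of the data, and $$\sigma_1=\frac{2\tau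 d(1+\log(2n_A/\eta))}{\sqrt{2\rho}\,n_A},\qquad \sigma_2=\frac{2\tau\sqrt d\,(1+\log(2n_A/\eta))}{\sqrt{2\rho}\,n_A}.$$ The output is $\hat\beta_A^{DP}$. **Theorem.** 1. *Privacy.* For all $d\ge1$, $n_A$, $n_B$, $\tau,\rho>0$, $\eta\in(0,1)$ and every fixed public dataset, the algorithm is $2\rho$-zCDP as a randomized function of the private dataset: if two private datasets differ in only one sample, the Rényi divergence of order $\alpha$ between the laws of the outputs is at most $2\rho\alpha$, for every $\alpha>1$. For every $K>0$ there are positive constants $\tau_0,C_1,C_2,C_3,c_1$, depending only on $K$, such that the following holds, where $$L=\frac{n_B}{\big(\sqrt{n_B}+C_2(\sqrt d+\sqrt{2\log(1/\eta)})\big)^2},\qquad q=1-C_3\,\frac{\sqrt d+\sqrt{\log(1/\eta)}}{\sqrt{n_A}} .$$ 2. *No truncation loss.* If $\tau\ge\tau_0$, $(\beta,\sigma)\ne(0,0)$, $\eta\in(0,1)$ and $\sqrt{n_B}\ge C_1(\sqrt d+\sqrt{2\log(1/\eta)})$, then with probability at least $1-c_1\eta$: $\hat\Sigma_B$ is positive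 definite, $\hat\sigma_B>0$, the truncation changes no transformed feature vector and no transformed response, and hence the ordinary least squares estimator of $(\tilde{\mathbf A},\tilde{\mathbf y}_A)$ equals $\tilde\beta_A$. 3. *Accuracy.* For every $\tau\ge\tau_0$ there is a constant $c_2>0$ depending only on $K,\tau$, and for every $s>0$ a constant $C>0$ depending only on $K,\tau,s$, such that the following holds for all $\rho>0$ and $\eta\in(0,1)$. Let $\beta\neq0$ and $\sigma\le s\,\|\Sigma\|^{1/2}\|\beta\|$, let $\sqrt{n_B}\ge C_1(\sqrt d+\sqrt{2\log(1/\eta)})$, and let $n_A$ be such that $$q>0\qquad\text{and}\qquad\frac{d^{3/2}(1+\log(2n_A/\eta))\log(1/\eta)}{\sqrt\rho\,n_A\,L\,q^2}\le\frac12 .$$ Then with probability at least $1-c_2\eta$: $\hat\Sigma_A$ and $\hat\Sigma_B$ are positive definite, $\hat\sigma_B>0$, $\tilde{\mathbf A}^\top\tilde{\mathbf A}/n_A+\mathbf G$ is invertible, $$\|\tilde\beta_A^{DP}-\tilde\beta_A\|\le C\,\frac{d^{3/2}\|\beta\|\,\|\hat\Sigma_A\|\,\|\hat\Sigma_B^{-1/2}\|\log(1/\eta)}{\hat\sigma_B\sqrt\rho\,n_A\,q^4}\cdot\frac{1+\log(2n_A/\eta)}{L^2}$$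 and $$\|\hat\beta_A^{DP}-\hat\beta_A\|\le C\,\frac{d^{3/2}\|\beta\|\,\|\hat\Sigma_A\|\,\|\hat\Sigma_B^{-1}\|\log(1/\eta)}{\sqrt\rho\,n_A\,q^4}\cdot\frac{1+\log(2n_A/\eta)}{L^2}.$$ -/

import Mathlib

open MeasureTheory ProbabilityTheory
open scoped Matrix ENNReal MatrixOrder

noncomputable section

namespace DPOLS

/-! ### Data, empirical moments, ordinary least squares -/

/-- Column vectors with the Euclidean norm. -/
abbrev Vec (d : ℕ) := EuclideanSpace ℝ (Fin d)

/-- A dataset of `n` samples, each a feature vector together with a real response. -/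
abbrev Dataset (n d : ℕ) := Fin n → Vec d × ℝ

/-- Operator (spectral) norm of a square matrix. -/
def opNorm {d : ℕ} (M : Matrix (Fin d) (Fin d) ℝ) : ℝ :=
  ‖Matrix.toEuclideanCLM (𝕜 := ℝ) M‖

/-- Matrix-vector product, as a map of Euclidean spaces. -/
def act {d : ℕ} (M : Matrix (Fin d) (Fin d) ℝ) (v : Vec d) : Vec d :=
  Matrix.toEuclideanCLM (𝕜 := ℝ) M v

/-- `S^{-1/2}`, for a positive definite matrix `S`. -/
def invSqrt {d : ℕ} (S : Matrix (Fin d) (Fin d) ℝ) : Matrix (Fin d) (Fin d) ℝ :=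
  (CFC.sqrt S)⁻¹

/-- The `n × d` data matrix, whose rows are the samples. -/
def designMatrix {n d : ℕ} (D : Dataset n d) : Matrix (Fin n) (Fin d) ℝ :=
  Matrix.of fun i j => (D i).1 j

/-- `XᵀX / n`. -/
def secondMoment {n d : ℕ} (D : Dataset n d) : Matrix (Fin d) (Fin d) ℝ :=
  (n : ℝ)⁻¹ • ((designMatrix D)ᵀ * designMatrix D)

/-- `Xᵀy / n`. -/
def crossMoment {n d : ℕ} (D : Dataset n d) : Vec d :=
  WithLp.toLp 2 ((n : ℝ)⁻¹ • ((designMatrix D)ᵀ *ᵥ fun i => (D i).2))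

/-- `√(∑ yᵢ² / n)`. -/
def responseScale {n d : ℕ} (D : Dataset n d) : ℝ :=
  √((n : ℝ)⁻¹ * ∑ i, (D i).2 ^ 2)

/-- The ordinary least squares estimator `(XᵀX/n)⁻¹ (Xᵀy/n)`. -/
def ols {n d : ℕ} (D : Dataset n d) : Vec d :=
  act (secondMoment D)⁻¹ (crossMoment D)

/-! ### Public-moment transformation and truncation -/

/-- Projection onto the ball of radius `R`: vectors of norm at least `R` are rescaled to
norm `R`, all others are kept. -/
def clip {V : Type*} [NormedAddCommGroup V] [NormedSpace ℝ V] (R : ℝ) (v : V) : V :=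
  open Classical in if R ≤ ‖v‖ then (R / ‖v‖) • v else v

/-- The truncation radius `√(τ m (1 + log (2n/η)))` in dimension `m`. -/
def truncRadius (τ : ℝ) (m n : ℕ) (η : ℝ) : ℝ :=
  √(τ * m * (1 + Real.log (2 * n / η)))

/-- Features multiplied by `Σ̂_B^{-1/2}`, responses divided by `σ̂_B`. -/
def transform {nA nB d : ℕ} (pub : Dataset nB d) (priv : Dataset nA d) : Dataset nA d :=
  fun i => (act (invSqrt (secondMoment pub)) (priv i).1, (priv i).2 / responseScale pub)

/-- Transformed features and responses, truncated (in dimensions `d` and `1`). -/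
def pmt (τ η : ℝ) {nA nB d : ℕ} (pub : Dataset nB d) (priv : Dataset nA d) : Dataset nA d :=
  fun i => (clip (truncRadius τ d nA η) (transform pub priv i).1,
    clip (truncRadius τ 1 nA η) (transform pub priv i).2)

/-- The transformed OLSE `(Σ̂_B^{1/2} / σ̂_B) β̂_A`. -/
def transformedOLS {nA nB d : ℕ} (pub : Dataset nB d) (priv : Dataset nA d) : Vec d :=
  (responseScale pub)⁻¹ • act (CFC.sqrt (secondMoment pub)) (ols priv)

/-! ### Gaussian perturbation and recovery -/

/-- Standard deviation of the entries of the noise matrix. -/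
def noiseScale₁ (τ ρ η : ℝ) (d n : ℕ) : ℝ :=
  2 * τ * d * (1 + Real.log (2 * n / η)) / (√(2 * ρ) * n)

/-- Standard deviation of the entries of the noise vector. -/
def noiseScale₂ (τ ρ η : ℝ) (d n : ℕ) : ℝ :=
  2 * τ * √d * (1 + Real.log (2 * n / η)) / (√(2 * ρ) * n)

/-- The symmetric matrix with the same entries as `W` on and above the diagonal. -/
def symMatrix {d : ℕ} (W : Fin d → Fin d → ℝ) : Matrix (Fin d) (Fin d) ℝ :=
  Matrix.of fun i j => W (min i j) (max i j)

/-- Law of the independent noises: an array with i.i.d. `N(0, σ₁²)` entries, to be symmetrized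
by `symMatrix`, and a vector `N(0, σ₂² I)`. -/
def noiseLaw (τ ρ η : ℝ) (d n : ℕ) : Measure ((Fin d → Fin d → ℝ) × Vec d) :=
  (Measure.pi fun _ => Measure.pi fun _ =>
      gaussianReal 0 (noiseScale₁ τ ρ η d n ^ 2).toNNReal).prod
    ((Measure.pi fun _ => gaussianReal 0 (noiseScale₂ τ ρ η d n ^ 2).toNNReal).map
      (WithLp.toLp 2))

/-- The perturbed second moment `ÃᵀÃ/n + G` of the transformed and truncated data. -/
def noisyMoment (τ η : ℝ) {nA nB d : ℕ} (pub : Dataset nB d) (priv : Dataset nA d)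
    (w : (Fin d → Fin d → ℝ) × Vec d) : Matrix (Fin d) (Fin d) ℝ :=
  secondMoment (pmt τ η pub priv) + symMatrix w.1

/-- `(ÃᵀÃ/n + G)⁻¹ (Ãᵀỹ/n + g)`, for given values `w = (G, g)` of the noises. -/
def dpTransformed (τ η : ℝ) {nA nB d : ℕ} (pub : Dataset nB d) (priv : Dataset nA d)
    (w : (Fin d → Fin d → ℝ) × Vec d) : Vec d :=
  act (noisyMoment τ η pub priv w)⁻¹ (crossMoment (pmt τ η pub priv) + w.2)

/-- The recovered estimator `σ̂_B Σ̂_B^{-1/2} β̃^DP`. -/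
def dpRecovered (τ η : ℝ) {nA nB d : ℕ} (pub : Dataset nB d) (priv : Dataset nA d)
    (w : (Fin d → Fin d → ℝ) × Vec d) : Vec d :=
  responseScale pub • act (invSqrt (secondMoment pub)) (dpTransformed τ η pub priv w)

/-- The randomized algorithm DP-PMTOLSE: the law of its output on a private dataset. -/
def dpPMTOLSE (τ ρ η : ℝ) {nA nB d : ℕ} (pub : Dataset nB d) (priv : Dataset nA d) :
    Measure (Vec d) :=
  (noiseLaw τ ρ η d nA).map (dpRecovered τ η pub priv)

/-! ### Zero-concentrated differential privacy -/

/-- Rényi divergence of order `α > 1` between probability measures. -/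
def renyiDiv {S : Type*} [MeasurableSpace S] (α : ℝ) (P Q : Measure S) : EReal :=
  open Classical in
  if P ≪ Q then (((α - 1)⁻¹ : ℝ) : EReal) * ENNReal.log (∫⁻ x, (P.rnDeriv Q x) ^ α ∂Q) else ⊤

/-- The two datasets differ in at most one sample. -/
def Neighbors {n : ℕ} {X : Type*} (D D' : Fin n → X) : Prop :=
  ∃ i, ∀ j, j ≠ i → D j = D' j

/-- `M` is a randomized algorithm that satisfies `ρ`-zCDP. -/
def IsZCDP {n : ℕ} {X S : Type*} [MeasurableSpace S] (M : (Fin n → X) → Measure S) (ρ : ℝ) :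
    Prop :=
  (∀ D, IsProbabilityMeasure (M D)) ∧
    ∀ D D', Neighbors D D' → ∀ α : ℝ, 1 < α → renyiDiv α (M D) (M D') ≤ ((ρ * α : ℝ) : EReal)

/-! ### The statistical model -/

/-- `ν` is a sub-Gaussian law on `ℝᵈ` with positive definite second-moment matrix `S`: every
marginal satisfies `‖⟨v, x⟩‖_{ψ₂} ≤ K (E⟨v, x⟩²)^{1/2}`, where
`‖X‖_{ψ₂} = inf {t > 0 | E exp (X²/t²) ≤ 2}`. Equivalently, the isotropic vector `S^{-1/2} x` has
sub-Gaussian norm at most `K`. No centering is assumed. -/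
structure IsSubG {d : ℕ} (ν : Measure (Vec d)) (S : Matrix (Fin d) (Fin d) ℝ) (K : ℝ) :
    Prop where
  isProbabilityMeasure : IsProbabilityMeasure ν
  posDef : S.PosDef
  integrable : ∀ i j, Integrable (fun x : Vec d => x i * x j) ν
  secondMoment_eq : ∀ i j, ∫ x : Vec d, x i * x j ∂ν = S i j
  psiTwo_le : ∀ v : Vec d,
    ∫⁻ x, ENNReal.ofReal (Real.exp (inner ℝ v x ^ 2 / (K ^ 2 * inner ℝ v (act S v)))) ∂ν ≤ 2

/-- Law of one sample `(x, ⟨x, β⟩ + ε)` with `x ∼ ν` and `ε ∼ N(0, σ²)` independent. -/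
def sampleLaw {d : ℕ} (ν : Measure (Vec d)) (β : Vec d) (σ : ℝ) : Measure (Vec d × ℝ) :=
  (ν.prod (gaussianReal 0 (σ ^ 2).toNNReal)).map fun p => (p.1, inner ℝ p.1 β + p.2)

/-- Joint law of the private and the public datasets, all samples being i.i.d. -/
def dataLaw {d : ℕ} (nA nB : ℕ) (ν : Measure (Vec d)) (β : Vec d) (σ : ℝ) :
    Measure (Dataset nA d × Dataset nB d) :=
  (Measure.pi fun _ => sampleLaw ν β σ).prod (Measure.pi fun _ => sampleLaw ν β σ)

/-! ### The quantities in the bounds -/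

/-- `L = n / (√n + C (√d + √(2 log (1/η))))²`. -/
def lowerEig (C : ℝ) (d n : ℕ) (η : ℝ) : ℝ :=
  n / (√n + C * (√d + √(2 * Real.log (1 / η)))) ^ 2

/-- `1 - C (√d + √(log (1/η))) / √n`. -/
def shrink (C : ℝ) (d n : ℕ) (η : ℝ) : ℝ :=
  1 - C * ((√d + √(Real.log (1 / η))) / √n)

/-- The event that the public moments `Σ̂_B` and `σ̂_B`, by which the data are divided, are positive
(definite), that truncation changes no sample, and that the OLSE of the truncated data is
the transformed OLSE of the original data. -/
def NoTruncationLoss (τ η : ℝ) {nA nB d : ℕ} (pub : Dataset nB d) (priv : Dataset nA d) : Prop :=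
  (secondMoment pub).PosDef ∧ 0 < responseScale pub ∧
    pmt τ η pub priv = transform pub priv ∧
    ols (pmt τ η pub priv) = transformedOLS pub priv

end DPOLS

end

/-!
Privacy: truncation bounds the effect of one sample on `ÃᵀÃ/n` and `Ãᵀỹ/n` in the Euclidean norms
of their coordinates, so adding `N(0, σ₁²)` and `N(0, σ₂²)` noise bounds every Rényi divergence, and
the output is a function of the noisy moments.

Utility: `⟨u, x⟩⟨v, x⟩` and `y²` are sub-exponential, so by Bernstein's inequality and a union bound
over a net of the sphere the empirical moments agree with the population ones up to a factor `3/2`.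
Hence `Σ̂_B^{-1/2} x` and `y / σ̂_B` have bounded second moments, and their tails make truncation
inactive; moreover `ÃᵀÃ/n ≥ 1/3`. The same nets bound the operator norm of `G` and the norm of `g`.
As soon as `‖G‖ ≤ 1/6`, the error `e` of the perturbed estimator, which solves
`(ÃᵀÃ/n + G) e = g - G β̃_A`, is at most `6 (‖g‖ + 3 ‖G‖)`. The condition on `n_A` gives
`‖G‖ ≤ 1/6` only when `log (1/η)` is large in terms of `τ`; otherwise `c₂ η ≥ 1`.
-/

noncomputable section

namespace DPOLS

/-! ### Rényi moments -/

lemma lintegral_pi_prod_apply {ι : Type*} [Fintype ι] {X : ι → Type*}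
    [∀ i, MeasurableSpace (X i)] (μ : ∀ i, Measure (X i)) [∀ i, IsProbabilityMeasure (μ i)]
    {f : ∀ i, X i → ℝ≥0∞} (hf : ∀ i, Measurable (f i)) :
    ∫⁻ ω, ∏ i, f i (ω i) ∂(Measure.pi μ) = ∏ i, ∫⁻ x, f i x ∂(μ i) := by
  rw [lintegral_prod_eq_prod_lintegral_of_indepFun Finset.univ
    (fun i (ω : ∀ i, X i) => f i (ω i)) (iIndepFun_pi (X := f) fun i => (hf i).aemeasurable)
    fun i => (hf i).comp (measurable_pi_apply i)]
  exact Finset.prod_congr rfl fun i _ => (measurePreserving_eval μ i).lintegral_comp (hf i)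

lemma pi_withDensity {ι : Type*} [Fintype ι] {X : ι → Type*} [∀ i, MeasurableSpace (X i)]
    (μ : ∀ i, Measure (X i)) [∀ i, IsProbabilityMeasure (μ i)] {h : ∀ i, X i → ℝ≥0∞}
    (hh : ∀ i, Measurable (h i)) [∀ i, SigmaFinite ((μ i).withDensity (h i))] :
    Measure.pi (fun i => (μ i).withDensity (h i)) =
      (Measure.pi μ).withDensity fun ω => ∏ i, h i (ω i) := by
  classical
  refine Measure.pi_eq fun s hs => ?_
  have indicator_prod : (Set.univ.pi s).indicator (fun ω => ∏ i, h i (ω i)) =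
      fun ω : ∀ i, X i => ∏ i, (s i).indicator (h i) (ω i) := by
    funext ω
    simp only [Set.indicator_apply, Finset.prod_ite_zero, Set.mem_univ_pi, Finset.mem_univ,
      true_imp_iff]
  rw [withDensity_apply _ (MeasurableSet.univ_pi hs),
    ← lintegral_indicator (MeasurableSet.univ_pi hs), indicator_prod,
    lintegral_pi_prod_apply μ fun i => (hh i).indicator (hs i)]
  exact Finset.prod_congr rfl fun i _ => by
    rw [lintegral_indicator (hs i), withDensity_apply _ (hs i)]

/-- `P` is absolutely continuous with respect to `Q`, and the `α`-th moment `∫ (dP/dQ)^α dQ` of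
its density, which is `exp ((α - 1) D_α(P ‖ Q))`, is at most `exp M`. In this form the Rényi
divergence is additive over product measures. -/
def RenyiMomentLE {S : Type*} [MeasurableSpace S] (α : ℝ) (P Q : Measure S) (M : ℝ) : Prop :=
  P ≪ Q ∧ ∫⁻ x, P.rnDeriv Q x ^ α ∂Q ≤ ENNReal.ofReal (Real.exp M)

section RenyiMoment

variable {S T : Type*} [MeasurableSpace S] [MeasurableSpace T] {α M M' : ℝ} {P Q : Measure S}
  {P' Q' : Measure T}

lemma renyiMomentLE_withDensity [SigmaFinite Q] {f : S → ℝ≥0∞} (hf : Measurable f)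
    (hM : ∫⁻ x, f x ^ α ∂Q ≤ ENNReal.ofReal (Real.exp M)) :
    RenyiMomentLE α (Q.withDensity f) Q M := by
  refine ⟨withDensity_absolutelyContinuous Q f, hM.trans_eq' (lintegral_congr_ae ?_)⟩
  filter_upwards [Measure.rnDeriv_withDensity Q hf] with x hx
  rw [hx]

lemma RenyiMomentLE.withDensity_rnDeriv_eq [SigmaFinite P] [SigmaFinite Q]
    (h : RenyiMomentLE α P Q M) : Q.withDensity (P.rnDeriv Q) = P :=
  Measure.withDensity_rnDeriv_eq P Q h.1

lemma RenyiMomentLE.mono (h : RenyiMomentLE α P Q M) (hM : M ≤ M') : RenyiMomentLE α P Q M' :=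
  ⟨h.1, h.2.trans (ENNReal.ofReal_le_ofReal (Real.exp_le_exp.2 hM))⟩

lemma RenyiMomentLE.prod [SigmaFinite P] [SigmaFinite Q] [SigmaFinite P'] [SigmaFinite Q']
    (hα : 0 ≤ α) (h : RenyiMomentLE α P Q M) (h' : RenyiMomentLE α P' Q' M') :
    RenyiMomentLE α (P.prod P') (Q.prod Q') (M + M') := by
  have hf := Measure.measurable_rnDeriv P Q
  have hg := Measure.measurable_rnDeriv P' Q'
  rw [← h.withDensity_rnDeriv_eq, ← h'.withDensity_rnDeriv_eq, prod_withDensity hf hg]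
  refine renyiMomentLE_withDensity (by fun_prop) ?_
  simp_rw [ENNReal.mul_rpow_of_nonneg _ _ hα]
  rw [lintegral_prod_mul (hf.pow_const α).aemeasurable (hg.pow_const α).aemeasurable,
    Real.exp_add, ENNReal.ofReal_mul (Real.exp_pos _).le]
  exact mul_le_mul' h.2 h'.2

lemma RenyiMomentLE.pi {ι : Type*} [Fintype ι] {X : ι → Type*} [∀ i, MeasurableSpace (X i)]
    {P Q : ∀ i, Measure (X i)} [∀ i, SigmaFinite (P i)] [∀ i, IsProbabilityMeasure (Q i)]
    {M : ι → ℝ} (hα : 0 ≤ α) (h : ∀ i, RenyiMomentLE α (P i) (Q i) (M i)) :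
    RenyiMomentLE α (Measure.pi P) (Measure.pi Q) (∑ i, M i) := by
  have hf := fun i => Measure.measurable_rnDeriv (P i) (Q i)
  have hP : P = fun i => (Q i).withDensity ((P i).rnDeriv (Q i)) :=
    funext fun i => (h i).withDensity_rnDeriv_eq.symm
  have : ∀ i, SigmaFinite ((Q i).withDensity ((P i).rnDeriv (Q i))) := fun i => by
    rw [(h i).withDensity_rnDeriv_eq]; infer_instance
  rw [hP, pi_withDensity Q hf]
  refine renyiMomentLE_withDensity (by fun_prop) ?_
  simp_rw [← ENNReal.prod_rpow_of_nonneg hα]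
  rw [lintegral_pi_prod_apply Q fun i => (hf i).pow_const α, Real.exp_sum,
    ENNReal.ofReal_prod_of_nonneg fun i _ => (Real.exp_pos _).le]
  exact Finset.prod_le_prod' fun i _ => (h i).2

lemma lintegral_rnDeriv_rpow_eq [SigmaFinite P] (hα : 0 ≤ α) :
    ∫⁻ x, P.rnDeriv Q x ^ α ∂Q = ∫⁻ x, ENNReal.ofReal ((P.rnDeriv Q x).toReal ^ α) ∂Q := by
  refine lintegral_congr_ae ((Measure.rnDeriv_lt_top P Q).mono fun x hx => ?_)
  simp only
  rw [← ENNReal.ofReal_rpow_of_nonneg ENNReal.toReal_nonneg hα, ENNReal.ofReal_toReal hx.ne]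

lemma lintegral_rnDeriv_map_rpow_le [IsFiniteMeasure P] [IsFiniteMeasure Q] (hα : 1 ≤ α)
    (hPQ : P ≪ Q) {φ : S → T} (hφ : Measurable φ) :
    ∫⁻ y, (P.map φ).rnDeriv (Q.map φ) y ^ α ∂(Q.map φ) ≤ ∫⁻ x, P.rnDeriv Q x ^ α ∂Q := by
  have hα0 : 0 ≤ α := zero_le_one.trans hα
  rcases eq_or_ne (∫⁻ x, P.rnDeriv Q x ^ α ∂Q) ∞ with htop | hfin
  · exact htop ▸ le_top
  have hmeas : Measurable fun x : ℝ => x ^ α := by fun_prop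
  have hcont : ContinuousWithinAt (fun x : ℝ => x ^ α) (Set.Ici 0) 0 :=
    (Real.continuous_rpow_const hα0).continuousWithinAt
  have hint : Integrable (fun x => (P.rnDeriv Q x).toReal ^ α) Q := by
    rw [lintegral_rnDeriv_rpow_eq hα0] at hfin
    exact lintegral_ofReal_ne_top_iff_integrable
      ((Measure.measurable_rnDeriv P Q).ennreal_toReal.pow_const α).aestronglyMeasurable
      (ae_of_all _ fun x => by positivity) |>.1 hfin
  have hint' := (convexOn_rpow hα).integrable_comp_rnDeriv_map hPQ hφ hmeas.stronglyMeasurable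
    hcont hint
  rw [lintegral_rnDeriv_rpow_eq hα0, lintegral_rnDeriv_rpow_eq hα0,
    ← ofReal_integral_eq_lintegral_ofReal hint' (ae_of_all _ fun x => by positivity),
    ← ofReal_integral_eq_lintegral_ofReal hint (ae_of_all _ fun x => by positivity)]
  refine ENNReal.ofReal_le_ofReal ?_
  rw [integral_map hφ.aemeasurable hint'.aestronglyMeasurable]
  exact (integral_mono_ae (hint'.comp_measurable hφ) integrable_condExp
    ((convexOn_rpow hα).comp_rnDeriv_map_le hPQ hφ hmeas.stronglyMeasurable hcont hint)).trans_eq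
      (integral_condExp hφ.comap_le)

lemma RenyiMomentLE.map [IsFiniteMeasure P] [IsFiniteMeasure Q] (hα : 1 ≤ α)
    (h : RenyiMomentLE α P Q M) {φ : S → T} (hφ : Measurable φ) :
    RenyiMomentLE α (P.map φ) (Q.map φ) M :=
  ⟨h.1.map hφ, (lintegral_rnDeriv_map_rpow_le hα h.1 hφ).trans h.2⟩

lemma RenyiMomentLE.renyiDiv_le (hα : 1 < α) (h : RenyiMomentLE α P Q ((α - 1) * M)) :
    renyiDiv α P Q ≤ (M : EReal) := by
  have hα1 : 0 < α - 1 := sub_pos.2 hα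
  rw [renyiDiv, if_pos h.1]
  calc (((α - 1)⁻¹ : ℝ) : EReal) * ENNReal.log (∫⁻ x, P.rnDeriv Q x ^ α ∂Q)
      ≤ (((α - 1)⁻¹ : ℝ) : EReal) * (((α - 1) * M : ℝ) : EReal) := by
        refine mul_le_mul_of_nonneg_left ?_ (by exact_mod_cast (inv_pos.2 hα1).le)
        refine (ENNReal.log_le_log h.2).trans_eq ?_
        rw [ENNReal.log_ofReal_of_pos (Real.exp_pos _), Real.log_exp]
    _ = (M : EReal) := by rw [← EReal.coe_mul, inv_mul_cancel_left₀ hα1.ne']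

end RenyiMoment

lemma gaussianPDF_eq_mul_ofReal_exp (m₁ m₂ : ℝ) {v : NNReal} (hv : v ≠ 0) (x : ℝ) :
    gaussianPDF m₁ v x = gaussianPDF m₂ v x *
      ENNReal.ofReal (Real.exp (((m₁ - m₂) * x - (m₁ ^ 2 - m₂ ^ 2) / 2) / v)) := by
  have hv' : (v : ℝ) ≠ 0 := by exact_mod_cast hv
  rw [gaussianPDF, gaussianPDF, ← ENNReal.ofReal_mul (gaussianPDFReal_nonneg _ _ _),
    gaussianPDFReal, gaussianPDFReal,
    mul_assoc _ _ (Real.exp (((m₁ - m₂) * x - (m₁ ^ 2 - m₂ ^ 2) / 2) / v)), ← Real.exp_add]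
  congr 3
  field_simp
  ring

lemma renyiMomentLE_gaussianReal (α m₁ m₂ : ℝ) {v : NNReal} (hv : v ≠ 0) :
    RenyiMomentLE α (gaussianReal m₁ v) (gaussianReal m₂ v)
      (α * (α - 1) * (m₁ - m₂) ^ 2 / (2 * v)) := by
  have hv' : (v : ℝ) ≠ 0 := by exact_mod_cast hv
  set g : ℝ → ℝ := fun x => Real.exp (((m₁ - m₂) * x - (m₁ ^ 2 - m₂ ^ 2) / 2) / v)
  have hgm : Measurable fun x => ENNReal.ofReal (g x) := by fun_prop
  have density : gaussianReal m₁ v = (gaussianReal m₂ v).withDensity fun x => .ofReal (g x) := by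
    rw [gaussianReal_of_var_ne_zero _ hv, gaussianReal_of_var_ne_zero _ hv,
      ← withDensity_mul _ (measurable_gaussianPDF _ _) hgm]
    exact congrArg _ (funext (gaussianPDF_eq_mul_ofReal_exp m₁ m₂ hv))
  -- Completing the square: tilting by `g ^ α` moves the mean to `m₂ + α (m₁ - m₂)`.
  have tilt (x : ℝ) : gaussianPDF m₂ v x * ENNReal.ofReal (g x) ^ α =
      ENNReal.ofReal (Real.exp (α * (α - 1) * (m₁ - m₂) ^ 2 / (2 * v))) *
        gaussianPDF (m₂ + α * (m₁ - m₂)) v x := by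
    rw [ENNReal.ofReal_rpow_of_pos (Real.exp_pos _),
      gaussianPDF_eq_mul_ofReal_exp (m₂ + α * (m₁ - m₂)) m₂ hv, mul_left_comm,
      ← ENNReal.ofReal_mul (Real.exp_pos _).le, ← Real.exp_mul, ← Real.exp_add]
    congr 3
    field_simp
    ring
  rw [density]
  refine renyiMomentLE_withDensity hgm (le_of_eq ?_)
  rw [gaussianReal_of_var_ne_zero _ hv, lintegral_withDensity_eq_lintegral_mul _
    (measurable_gaussianPDF _ _) (hgm.pow_const _)]
  simp only [Pi.mul_apply, tilt]
  rw [lintegral_const_mul _ (measurable_gaussianPDF _ _), lintegral_gaussianPDF_eq_one _ hv,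
    mul_one]

/-! ### Sensitivity and privacy -/

lemma secondMoment_apply {n d : ℕ} (D : Dataset n d) (j k : Fin d) :
    secondMoment D j k = (n : ℝ)⁻¹ * ∑ i, (D i).1 j * (D i).1 k := by
  simp [secondMoment, designMatrix, Matrix.mul_apply]

lemma crossMoment_apply {n d : ℕ} (D : Dataset n d) (j : Fin d) :
    crossMoment D j = (n : ℝ)⁻¹ * ∑ i, (D i).1 j * (D i).2 := by
  simp [crossMoment, designMatrix, Matrix.mulVec, dotProduct]

lemma secondMoment_comm {n d : ℕ} (D : Dataset n d) (j k : Fin d) :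
    secondMoment D j k = secondMoment D k j := by
  simp_rw [secondMoment_apply, mul_comm]

lemma norm_clip_le {V : Type*} [NormedAddCommGroup V] [NormedSpace ℝ V] {R : ℝ} (hR : 0 ≤ R)
    (v : V) : ‖clip R v‖ ≤ R := by
  unfold clip
  split_ifs with h
  · rw [norm_smul, norm_div, norm_norm, Real.norm_of_nonneg hR,
      div_mul_eq_mul_div, mul_div_assoc]
    exact mul_le_of_le_one_right hR (div_self_le_one _)
  · exact (not_le.1 h).le

lemma Neighbors.sum_mean_sub_sq_le {n : ℕ} {X ι : Type*} [Fintype ι] {D D' : Fin n → X}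
    (h : Neighbors D D') {f : X → ι → ℝ} {b : ℝ} (hD : ∀ i, ∑ k, f (D i) k ^ 2 ≤ b)
    (hD' : ∀ i, ∑ k, f (D' i) k ^ 2 ≤ b) :
    ∑ k, ((n : ℝ)⁻¹ * ∑ l, f (D l) k - (n : ℝ)⁻¹ * ∑ l, f (D' l) k) ^ 2 ≤
      4 * b / (n : ℝ) ^ 2 := by
  obtain ⟨i, hi⟩ := h
  have sub_eq (k : ι) : ∑ l, f (D l) k - ∑ l, f (D' l) k = f (D i) k - f (D' i) k := by
    rw [← Finset.sum_sub_distrib]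
    exact Finset.sum_eq_single i (fun j _ hj => by rw [hi j hj, sub_self]) (by simp)
  calc ∑ k, ((n : ℝ)⁻¹ * ∑ l, f (D l) k - (n : ℝ)⁻¹ * ∑ l, f (D' l) k) ^ 2
      = ((n : ℝ)⁻¹) ^ 2 * ∑ k, (f (D i) k - f (D' i) k) ^ 2 := by
        simp_rw [← mul_sub, sub_eq, mul_pow, ← Finset.mul_sum]
    _ ≤ ((n : ℝ)⁻¹) ^ 2 * ∑ k, (2 * f (D i) k ^ 2 + 2 * f (D' i) k ^ 2) := by
        gcongr with k
        linarith [sq_nonneg (f (D i) k + f (D' i) k)]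
    _ = ((n : ℝ)⁻¹) ^ 2 * (2 * ∑ k, f (D i) k ^ 2 + 2 * ∑ k, f (D' i) k ^ 2) := by
        simp only [← Finset.mul_sum, Finset.sum_add_distrib]
    _ ≤ ((n : ℝ)⁻¹) ^ 2 * (2 * b + 2 * b) := by gcongr <;> apply_assumption
    _ = 4 * b / (n : ℝ) ^ 2 := by ring

lemma Neighbors.sum_secondMoment_sub_sq_le {n d : ℕ} {D D' : Dataset n d} (h : Neighbors D D')
    {R : ℝ} (hD : ∀ i, ‖(D i).1‖ ≤ R) (hD' : ∀ i, ‖(D' i).1‖ ≤ R) :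
    ∑ j, ∑ k, (secondMoment D j k - secondMoment D' j k) ^ 2 ≤
      4 * (R ^ 2) ^ 2 / (n : ℝ) ^ 2 := by
  have sum_sq_le (v : Vec d) (hv : ‖v‖ ≤ R) : ∑ p : Fin d × Fin d, (v p.1 * v p.2) ^ 2 ≤
      (R ^ 2) ^ 2 := by
    simp_rw [Fintype.sum_prod_type, mul_pow]
    rw [← Finset.sum_mul_sum, ← EuclideanSpace.real_norm_sq_eq, ← sq]
    gcongr
  have := h.sum_mean_sub_sq_le (f := fun z (p : Fin d × Fin d) => z.1 p.1 * z.1 p.2)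
    (fun i => sum_sq_le _ (hD i)) fun i => sum_sq_le _ (hD' i)
  simpa only [secondMoment_apply, Fintype.sum_prod_type] using this

lemma Neighbors.sum_crossMoment_sub_sq_le {n d : ℕ} {D D' : Dataset n d} (h : Neighbors D D')
    {R r : ℝ} (hD : ∀ i, ‖(D i).1‖ ≤ R ∧ ‖(D i).2‖ ≤ r)
    (hD' : ∀ i, ‖(D' i).1‖ ≤ R ∧ ‖(D' i).2‖ ≤ r) :
    ∑ j, (crossMoment D j - crossMoment D' j) ^ 2 ≤ 4 * (R ^ 2 * r ^ 2) / (n : ℝ) ^ 2 := by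
  have sum_sq_le (z : Vec d × ℝ) (hz : ‖z.1‖ ≤ R ∧ ‖z.2‖ ≤ r) :
      ∑ j, (z.1 j * z.2) ^ 2 ≤ R ^ 2 * r ^ 2 := by
    simp_rw [mul_pow]
    rw [← Finset.sum_mul, ← EuclideanSpace.real_norm_sq_eq, ← sq_abs z.2, ← Real.norm_eq_abs]
    gcongr
    exacts [hz.1, hz.2]
  simp_rw [crossMoment_apply]
  exact h.sum_mean_sub_sq_le (f := fun z j => z.1 j * z.2) (fun i => sum_sq_le _ (hD i))
    fun i => sum_sq_le _ (hD' i)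

lemma Neighbors.pmt {τ η : ℝ} {nA nB d : ℕ} {D D' : Dataset nA d} (h : Neighbors D D')
    (pub : Dataset nB d) : Neighbors (pmt τ η pub D) (pmt τ η pub D') := by
  obtain ⟨i, hi⟩ := h
  exact ⟨i, fun j hj => by simp only [DPOLS.pmt, transform, hi j hj]⟩

lemma norm_pmt_le (τ η : ℝ) {nA nB d : ℕ} (pub : Dataset nB d) (priv : Dataset nA d)
    (i : Fin nA) : ‖(pmt τ η pub priv i).1‖ ≤ truncRadius τ d nA η ∧
      ‖(pmt τ η pub priv i).2‖ ≤ truncRadius τ 1 nA η :=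
  ⟨norm_clip_le (Real.sqrt_nonneg _) _, norm_clip_le (Real.sqrt_nonneg _) _⟩

/-- Joint law of an array with independent `N(A i j, v₁)` entries and a vector with independent
`N(b j, v₂)` entries: the Gaussian mechanism applied to the pair of statistics `(A, b)`. -/
def gaussianRelease {d : ℕ} (v₁ v₂ : NNReal) (A : Fin d → Fin d → ℝ)
    (b : Vec d) : Measure ((Fin d → Fin d → ℝ) × Vec d) :=
  (Measure.pi fun i => Measure.pi fun j => gaussianReal (A i j) v₁).prod
    ((Measure.pi fun j => gaussianReal (b j) v₂).map (WithLp.toLp 2))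

lemma measurable_toLp_vec (d : ℕ) : Measurable (WithLp.toLp 2 : (Fin d → ℝ) → Vec d) :=
  WithLp.measurable_toLp 2 (Fin d → ℝ)

instance isProbabilityMeasure_map_toLp {d : ℕ} (μ : Measure (Fin d → ℝ))
    [IsProbabilityMeasure μ] : IsProbabilityMeasure (μ.map (WithLp.toLp 2 : _ → Vec d)) :=
  Measure.isProbabilityMeasure_map (measurable_toLp_vec d).aemeasurable

instance isProbabilityMeasure_gaussianRelease {d : ℕ} (v₁ v₂ : NNReal)
    (A : Fin d → Fin d → ℝ) (b : Vec d) :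
    IsProbabilityMeasure (gaussianRelease v₁ v₂ A b) := by
  unfold gaussianRelease
  infer_instance

lemma noiseLaw_eq_gaussianRelease (τ ρ η : ℝ) (d n : ℕ) :
    noiseLaw τ ρ η d n = gaussianRelease (noiseScale₁ τ ρ η d n ^ 2).toNNReal
      (noiseScale₂ τ ρ η d n ^ 2).toNNReal 0 0 := rfl

instance isProbabilityMeasure_noiseLaw (τ ρ η : ℝ) (d n : ℕ) :
    IsProbabilityMeasure (noiseLaw τ ρ η d n) := by
  rw [noiseLaw_eq_gaussianRelease]; infer_instance

lemma pi_gaussianReal_map_add {ι : Type*} [Fintype ι] (m : ι → ℝ) (v : ι → NNReal) (b : ι → ℝ) :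
    (Measure.pi fun i => gaussianReal (m i) (v i)).map (fun w i => w i + b i) =
      Measure.pi fun i => gaussianReal (m i + b i) (v i) := by
  rw [Measure.pi_map_pi (f := fun i x => x + b i) fun i => by fun_prop]
  simp only [gaussianReal_map_add_const]

lemma gaussianRelease_map_add {d : ℕ} (v₁ v₂ : NNReal) (A : Fin d → Fin d → ℝ) (b : Vec d) :
    (gaussianRelease v₁ v₂ 0 0).map (fun w => ((fun i j => w.1 i j + A i j), w.2 + b)) =
      gaussianRelease v₁ v₂ A b := by
  have row (i : Fin d) : (Measure.pi fun _ => gaussianReal (0 : ℝ) v₁).map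
      (fun w j => w j + A i j) = Measure.pi fun j => gaussianReal (A i j) v₁ := by
    simp only [pi_gaussianReal_map_add, zero_add]
  have (i : Fin d) : IsProbabilityMeasure ((Measure.pi fun _ : Fin d =>
      gaussianReal (0 : ℝ) v₁).map (fun w j => w j + A i j)) := by rw [row]; infer_instance
  have array : (Measure.pi fun _ : Fin d =>
      Measure.pi fun _ : Fin d => gaussianReal (0 : ℝ) v₁).map (fun w i j => w i j + A i j) =
      Measure.pi fun i => Measure.pi fun j => gaussianReal (A i j) v₁ := by
    rw [Measure.pi_map_pi (f := fun i (w : Fin d → ℝ) j => w j + A i j) fun i =>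
      (show Measurable fun (w : Fin d → ℝ) j => w j + A i j by fun_prop).aemeasurable]
    simp_rw [row]
  have vector : ((Measure.pi fun _ : Fin d => gaussianReal (0 : ℝ) v₂).map
      (WithLp.toLp 2)).map (fun w : Vec d => w + b) =
      (Measure.pi fun j => gaussianReal (b j) v₂).map (WithLp.toLp 2) := by
    have shift := pi_gaussianReal_map_add (fun _ : Fin d => 0) (fun _ => v₂) b
    simp only [zero_add] at shift
    rw [← shift, Measure.map_map (by fun_prop) (measurable_toLp_vec d),
      Measure.map_map (measurable_toLp_vec d) (by fun_prop)]
    rfl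
  unfold gaussianRelease
  rw [← array, ← vector, Measure.map_prod_map _ _ (by fun_prop) (by fun_prop)]
  rfl

lemma renyiMomentLE_gaussianRelease {d : ℕ} {α : ℝ} (hα : 1 ≤ α) {v₁ v₂ : NNReal} (hv₁ : v₁ ≠ 0)
    (hv₂ : v₂ ≠ 0) (A A' : Fin d → Fin d → ℝ) (b b' : Vec d) :
    RenyiMomentLE α (gaussianRelease v₁ v₂ A b) (gaussianRelease v₁ v₂ A' b')
      (α * (α - 1) * ((∑ i, ∑ j, (A i j - A' i j) ^ 2) / (2 * v₁) +
        (∑ j, (b j - b' j) ^ 2) / (2 * v₂))) := by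
  have hα0 : 0 ≤ α := zero_le_one.trans hα
  have array := RenyiMomentLE.pi hα0 fun i => RenyiMomentLE.pi hα0 fun j =>
    renyiMomentLE_gaussianReal α (A i j) (A' i j) hv₁
  have vector := (RenyiMomentLE.pi hα0 fun j =>
    renyiMomentLE_gaussianReal α (b j) (b' j) hv₂).map hα (measurable_toLp_vec d)
  refine (array.prod hα0 vector).mono (le_of_eq ?_)
  simp only [Finset.sum_div, Finset.mul_sum, mul_add, mul_div_assoc]

/-- The output of the algorithm as a function of the perturbed moments `(ÃᵀÃ/n + G, Ãᵀỹ/n + g)`,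
the first of which is given by its entries on and above the diagonal. -/
def recoverFromMoments {nB d : ℕ} (pub : Dataset nB d) (z : (Fin d → Fin d → ℝ) × Vec d) : Vec d :=
  responseScale pub • act (invSqrt (secondMoment pub)) (act (symMatrix z.1)⁻¹ z.2)

lemma continuous_symMatrix (d : ℕ) :
    Continuous (symMatrix : (Fin d → Fin d → ℝ) → Matrix (Fin d) (Fin d) ℝ) := by
  refine continuous_matrix fun i j => ?_
  simp only [symMatrix, Matrix.of_apply]
  fun_prop

lemma measurable_recoverFromMoments {nB d : ℕ} (pub : Dataset nB d) :
    Measurable (recoverFromMoments pub) := by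
  have entry (i j : Fin d) : Measurable fun z : (Fin d → Fin d → ℝ) × Vec d =>
      (symMatrix z.1)⁻¹ i j := by
    have hsym := (continuous_symMatrix d).comp (continuous_fst (Y := Vec d))
    simp only [Matrix.inv_def, Ring.inverse_eq_inv', Matrix.smul_apply, smul_eq_mul]
    exact hsym.matrix_det.measurable.inv.mul (hsym.matrix_adjugate.matrix_elem i j).measurable
  have solve : Measurable fun z : (Fin d → Fin d → ℝ) × Vec d => act (symMatrix z.1)⁻¹ z.2 := by
    change Measurable fun z : (Fin d → Fin d → ℝ) × Vec d =>
      (WithLp.toLp 2 (fun i => ∑ j, (symMatrix z.1)⁻¹ i j * z.2 j) : Vec d)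
    refine (measurable_toLp_vec d).comp (measurable_pi_lambda _ fun i => ?_)
    exact Finset.measurable_sum _ fun j _ => (entry i j).mul (by fun_prop)
  unfold recoverFromMoments act
  exact ((Matrix.toEuclideanCLM (𝕜 := ℝ) (invSqrt (secondMoment pub))).measurable.comp
    solve).const_smul (responseScale pub)

lemma symMatrix_add_of_symm {d : ℕ} {A : Matrix (Fin d) (Fin d) ℝ} (hA : ∀ i j, A i j = A j i)
    (W : Fin d → Fin d → ℝ) :
    symMatrix (fun i j => W i j + A i j) = A + symMatrix W := by
  ext i j
  simp only [symMatrix, Matrix.of_apply, Matrix.add_apply]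
  rcases le_total i j with h | h
  · rw [min_eq_left h, max_eq_right h, add_comm]
  · rw [min_eq_right h, max_eq_left h, add_comm, hA]

lemma dpPMTOLSE_eq_map (τ ρ η : ℝ) {nA nB d : ℕ} (pub : Dataset nB d) (priv : Dataset nA d) :
    dpPMTOLSE τ ρ η pub priv =
      (gaussianRelease (noiseScale₁ τ ρ η d nA ^ 2).toNNReal
        (noiseScale₂ τ ρ η d nA ^ 2).toNNReal (secondMoment (pmt τ η pub priv))
        (crossMoment (pmt τ η pub priv))).map (recoverFromMoments pub) := by
  rw [dpPMTOLSE, noiseLaw_eq_gaussianRelease,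
    ← gaussianRelease_map_add _ _ (secondMoment (pmt τ η pub priv)),
    Measure.map_map (measurable_recoverFromMoments pub) (by fun_prop)]
  congr 1
  funext w
  simp only [dpRecovered, dpTransformed, noisyMoment, Function.comp_apply, recoverFromMoments,
    symMatrix_add_of_symm (secondMoment_comm _), add_comm w.2]

instance isProbabilityMeasure_dpPMTOLSE (τ ρ η : ℝ) {nA nB d : ℕ} (pub : Dataset nB d)
    (priv : Dataset nA d) : IsProbabilityMeasure (dpPMTOLSE τ ρ η pub priv) := by
  rw [dpPMTOLSE_eq_map]
  have := isProbabilityMeasure_gaussianRelease (noiseScale₁ τ ρ η d nA ^ 2).toNNReal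
    (noiseScale₂ τ ρ η d nA ^ 2).toNNReal (secondMoment (pmt τ η pub priv))
    (crossMoment (pmt τ η pub priv))
  exact Measure.isProbabilityMeasure_map (measurable_recoverFromMoments pub).aemeasurable

lemma log_two_mul_div_nonneg {n : ℕ} (hn : 0 < n) {η : ℝ} (hη : 0 < η) (hη1 : η < 1) :
    0 ≤ Real.log (2 * n / η) := by
  have hn1 : (1 : ℝ) ≤ n := by exact_mod_cast hn
  exact Real.log_nonneg (by rw [le_div_iff₀ hη]; linarith)

lemma one_add_log_pos {n : ℕ} (hn : 0 < n) {η : ℝ} (hη : 0 < η) (hη1 : η < 1) :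
    0 < 1 + Real.log (2 * n / η) := by
  linarith [log_two_mul_div_nonneg hn hη hη1]

section NoiseScale

variable {τ ρ η : ℝ} {d n : ℕ}

lemma truncRadius_sq (hτ : 0 < τ) (m : ℕ) (hn : 0 < n) (hη : 0 < η) (hη1 : η < 1) :
    truncRadius τ m n η ^ 2 = τ * m * (1 + Real.log (2 * n / η)) :=
  Real.sq_sqrt (mul_nonneg (by positivity) (one_add_log_pos hn hη hη1).le)

lemma noiseScale₁_sq (hτ : 0 < τ) (hρ : 0 < ρ) (hn : 0 < n) (hη : 0 < η) (hη1 : η < 1) :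
    noiseScale₁ τ ρ η d n ^ 2 = 2 * (truncRadius τ d n η ^ 2) ^ 2 / (ρ * n ^ 2) := by
  rw [truncRadius_sq hτ d hn hη hη1, noiseScale₁, div_pow, mul_pow (√(2 * ρ)),
    Real.sq_sqrt (by positivity)]
  field_simp

lemma noiseScale₂_sq (hτ : 0 < τ) (hρ : 0 < ρ) (hn : 0 < n) (hη : 0 < η) (hη1 : η < 1) :
    noiseScale₂ τ ρ η d n ^ 2 =
      2 * (truncRadius τ d n η ^ 2 * truncRadius τ 1 n η ^ 2) / (ρ * n ^ 2) := by
  rw [truncRadius_sq hτ d hn hη hη1, truncRadius_sq hτ 1 hn hη hη1, noiseScale₂, div_pow,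
    mul_pow (√(2 * ρ)), Real.sq_sqrt (by positivity), mul_pow, mul_pow (2 * τ),
    Real.sq_sqrt d.cast_nonneg, Nat.cast_one]
  field_simp

lemma noiseScale_pos (hd : 0 < d) (hτ : 0 < τ) (hρ : 0 < ρ) (hn : 0 < n) (hη : 0 < η)
    (hη1 : η < 1) : 0 < noiseScale₁ τ ρ η d n ∧ 0 < noiseScale₂ τ ρ η d n := by
  have := one_add_log_pos hn hη hη1
  unfold noiseScale₁ noiseScale₂
  constructor <;> positivity

end NoiseScale

/-- Each of the two released moments consumes a privacy budget of `ρ`. -/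
theorem isZCDP_dpPMTOLSE (d nA nB : ℕ) (τ ρ η : ℝ) (hd : 0 < d) (hτ : 0 < τ) (hρ : 0 < ρ)
    (hη : 0 < η) (hη1 : η < 1) (pub : Dataset nB d) :
    IsZCDP (fun priv : Dataset nA d => dpPMTOLSE τ ρ η pub priv) (2 * ρ) := by
  refine ⟨fun priv => inferInstance, fun D D' hDD α hα => RenyiMomentLE.renyiDiv_le hα ?_⟩
  have hn : 0 < nA := Fin.pos hDD.choose
  obtain ⟨hs₁, hs₂⟩ := noiseScale_pos hd hτ hρ hn hη hη1
  have hv₁ : (noiseScale₁ τ ρ η d nA ^ 2).toNNReal ≠ 0 :=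
    (Real.toNNReal_pos.2 (by positivity)).ne'
  have hv₂ : (noiseScale₂ τ ρ η d nA ^ 2).toNNReal ≠ 0 :=
    (Real.toNNReal_pos.2 (by positivity)).ne'
  simp only [dpPMTOLSE_eq_map]
  refine ((renyiMomentLE_gaussianRelease hα.le hv₁ hv₂ _ _ _ _).map hα.le
    (measurable_recoverFromMoments pub)).mono ?_
  rw [Real.coe_toNNReal _ (sq_nonneg _), Real.coe_toNNReal _ (sq_nonneg _)]
  have hpmt := norm_pmt_le τ η pub D
  have hpmt' := norm_pmt_le τ η pub D'
  have moment_cost : (∑ i, ∑ j, (secondMoment (pmt τ η pub D) i j -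
      secondMoment (pmt τ η pub D') i j) ^ 2) / (2 * noiseScale₁ τ ρ η d nA ^ 2) ≤ ρ := by
    rw [div_le_iff₀ (by positivity), noiseScale₁_sq hτ hρ hn hη hη1]
    refine ((hDD.pmt pub).sum_secondMoment_sub_sq_le (fun i => (hpmt i).1)
      fun i => (hpmt' i).1).trans_eq ?_
    field_simp
    ring
  have cross_cost : (∑ j, (crossMoment (pmt τ η pub D) j - crossMoment (pmt τ η pub D') j) ^ 2) /
      (2 * noiseScale₂ τ ρ η d nA ^ 2) ≤ ρ := by
    rw [div_le_iff₀ (by positivity), noiseScale₂_sq hτ hρ hn hη hη1]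
    refine ((hDD.pmt pub).sum_crossMoment_sub_sq_le hpmt hpmt').trans_eq ?_
    field_simp
    ring
  have hα1 : 0 ≤ α * (α - 1) := mul_nonneg (by linarith) (by linarith)
  refine (mul_le_mul_of_nonneg_left (add_le_add moment_cost cross_cost) hα1).trans_eq ?_
  ring

/-! ### Sub-exponential random variables -/

lemma exp_le_one_add_self_add_sq_mul (u : ℝ) :
    Real.exp u ≤ 1 + u + u ^ 2 * Real.exp |u| := by
  have hTaylor := Complex.norm_exp_sub_sum_le_norm_mul_exp (u : ℂ) 2
  have hreal : (Complex.exp u - ∑ m ∈ Finset.range 2, (u : ℂ) ^ m / m.factorial) =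
      ((Real.exp u - (1 + u) : ℝ) : ℂ) := by
    simp [Finset.sum_range_succ]
  rw [hreal, Complex.norm_real, Complex.norm_real, Real.norm_eq_abs, Real.norm_eq_abs,
    sq_abs] at hTaylor
  linarith [le_abs_self (Real.exp u - (1 + u))]

lemma exp_mul_le_one_add_mul_add {b l : ℝ} (hb : 0 < b) (hl : |l| ≤ 1 / (2 * b)) (x : ℝ) :
    Real.exp (l * x) ≤ 1 + l * x + 8 * l ^ 2 * b ^ 2 * Real.exp (|x| / b) := by
  refine (exp_le_one_add_self_add_sq_mul _).trans (add_le_add le_rfl ?_)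
  set s := |x| / (2 * b) with hs
  have hlx : |l * x| ≤ s := by
    rw [abs_mul, hs, div_eq_mul_one_div, mul_comm]
    gcongr
  have hsq : (l * x) ^ 2 = l ^ 2 * (4 * b ^ 2 * s ^ 2) := by
    rw [mul_pow, ← sq_abs x, hs]
    field_simp
    ring
  have hs_sq : s ^ 2 ≤ 2 * Real.exp s := by
    have := Real.pow_div_factorial_le_exp s (by positivity) 2
    norm_num at this
    linarith
  have hs_add : |x| / b = s + s := by
    rw [hs]
    field_simp
    ring
  rw [hs_add, Real.exp_add, hsq]
  calc l ^ 2 * (4 * b ^ 2 * s ^ 2) * Real.exp |l * x|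
      ≤ l ^ 2 * (4 * b ^ 2 * (2 * Real.exp s)) * Real.exp s := by gcongr
    _ = _ := by ring

/-- The random variable `X` is sub-exponential with `‖X‖_{ψ₁} ≤ b`, that is `E exp (|X|/b) ≤ 2`.
As `x / 0 = 0`, the condition is void for `b = 0` under a probability measure. -/
def PsiOneLE {Ω : Type*} [MeasurableSpace Ω] (X : Ω → ℝ) (b : ℝ) (μ : Measure Ω) : Prop :=
  ∫⁻ ω, ENNReal.ofReal (Real.exp (|X ω| / b)) ∂μ ≤ 2

/-- The exponent in Bernstein's inequality: an average of `n` independent copies of `X`, where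
`‖X‖_{ψ₁} ≤ b`, deviates by `t` from its mean with probability at most
`2 exp (-bernsteinRate b t * n)`. -/
def bernsteinRate (b t : ℝ) : ℝ :=
  min (t / (32 * b ^ 2)) (1 / (2 * b)) * t / 2

namespace PsiOneLE

variable {Ω : Type*} [MeasurableSpace Ω] {μ : Measure Ω} {X : Ω → ℝ} {b : ℝ}

lemma neg (h : PsiOneLE X b μ) : PsiOneLE (-X) b μ := by
  simpa only [PsiOneLE, Pi.neg_apply, abs_neg] using h

lemma comp_iff {Ω' : Type*} [MeasurableSpace Ω'] {μ' : Measure Ω'} {f : Ω' → Ω}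
    (hf : MeasurePreserving f μ' μ) (hX : Measurable X) :
    PsiOneLE (fun ω => X (f ω)) b μ' ↔ PsiOneLE X b μ := by
  have hcomp := hf.lintegral_comp (f := fun ω => ENNReal.ofReal (Real.exp (|X ω| / b)))
    (by fun_prop)
  rw [PsiOneLE, PsiOneLE, hcomp]

lemma of_abs_le_half_add {Y Z : Ω → ℝ} {c : ℝ} (hY : PsiOneLE Y c μ) (hZ : PsiOneLE Z c μ)
    (hYm : Measurable Y) (hZm : Measurable Z)
    (hle : ∀ ω, |X ω| / b ≤ (|Y ω| / c + |Z ω| / c) / 2) : PsiOneLE X b μ := by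
  have hconvex (x y : ℝ) :
      Real.exp ((x + y) / 2) ≤ 2⁻¹ * (Real.exp x + Real.exp y) := by
    have h := (convexOn_iff_forall_pos.1 convexOn_exp).2 (Set.mem_univ x) (Set.mem_univ y)
      (inv_pos.2 two_pos) (inv_pos.2 two_pos) (by norm_num)
    simpa only [smul_eq_mul, ← mul_add, div_eq_inv_mul] using h
  have hhalf : ENNReal.ofReal 2⁻¹ = 2⁻¹ := by
    rw [ENNReal.ofReal_inv_of_pos two_pos, ENNReal.ofReal_ofNat]
  calc ∫⁻ ω, ENNReal.ofReal (Real.exp (|X ω| / b)) ∂μ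
      ≤ ∫⁻ ω, 2⁻¹ * (ENNReal.ofReal (Real.exp (|Y ω| / c)) +
          ENNReal.ofReal (Real.exp (|Z ω| / c))) ∂μ := by
        refine lintegral_mono fun ω => ?_
        rw [← ENNReal.ofReal_add (Real.exp_pos _).le (Real.exp_pos _).le, ← hhalf,
          ← ENNReal.ofReal_mul (by norm_num)]
        exact ENNReal.ofReal_le_ofReal ((Real.exp_le_exp.2 (hle ω)).trans (hconvex _ _))
    _ ≤ 2⁻¹ * (2 + 2) := by
        rw [lintegral_const_mul _ (by fun_prop), lintegral_add_left (by fun_prop)]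
        exact mul_le_mul_right (add_le_add hY hZ) _
    _ = 2 := by
        rw [← two_mul, ← mul_assoc, ENNReal.inv_mul_cancel two_ne_zero ENNReal.ofNat_ne_top,
          one_mul]

lemma integrable_exp (h : PsiOneLE X b μ) (hX : Measurable X) :
    Integrable (fun ω => Real.exp (|X ω| / b)) μ := by
  refine ⟨by fun_prop, ?_⟩
  rw [hasFiniteIntegral_iff_ofReal (.of_forall fun _ => (Real.exp_pos _).le)]
  exact h.trans_lt (by simp)

lemma integral_exp_le (h : PsiOneLE X b μ) (hX : Measurable X) :
    ∫ ω, Real.exp (|X ω| / b) ∂μ ≤ 2 := by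
  rw [integral_eq_lintegral_of_nonneg_ae (.of_forall fun _ => (Real.exp_pos _).le)
    (h.integrable_exp hX).aestronglyMeasurable]
  exact ENNReal.toReal_le_of_le_ofReal zero_le_two (by rwa [ENNReal.ofReal_ofNat])

lemma integrable (h : PsiOneLE X b μ) (hb : 0 < b) (hX : Measurable X) : Integrable X μ := by
  refine ((h.integrable_exp hX).const_mul b).mono' hX.aestronglyMeasurable (.of_forall fun ω => ?_)
  calc ‖X ω‖ = b * (|X ω| / b) := by rw [Real.norm_eq_abs]; field_simp
    _ ≤ b * Real.exp (|X ω| / b) := by gcongr; linarith [Real.add_one_le_exp (|X ω| / b)]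

lemma measure_ge_le (h : PsiOneLE X b μ) (hb : 0 < b) (hX : Measurable X) (t : ℝ) :
    μ {ω | t ≤ |X ω|} ≤ ENNReal.ofReal (2 * Real.exp (-(t / b))) := by
  have hset : {ω | t ≤ |X ω|} ⊆
      {ω | ENNReal.ofReal (Real.exp (t / b)) ≤ ENNReal.ofReal (Real.exp (|X ω| / b))} :=
    fun ω hω => ENNReal.ofReal_le_ofReal (Real.exp_le_exp.2 (div_le_div_of_nonneg_right hω hb.le))
  have hpos : ENNReal.ofReal (Real.exp (t / b)) ≠ 0 := by simp [Real.exp_pos]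
  calc μ {ω | t ≤ |X ω|} ≤ 2 / ENNReal.ofReal (Real.exp (t / b)) :=
        (measure_mono hset).trans ((meas_ge_le_lintegral_div (by fun_prop) hpos
          ENNReal.ofReal_ne_top).trans (ENNReal.div_le_div_right h _))
    _ = ENNReal.ofReal (2 * Real.exp (-(t / b))) := by
        rw [Real.exp_neg, ← div_eq_mul_inv, ENNReal.ofReal_div_of_pos (Real.exp_pos _),
          ENNReal.ofReal_ofNat]

lemma integrable_exp_mul_sub_integral (h : PsiOneLE X b μ) (hb : 0 < b) (hX : Measurable X)
    {l : ℝ} (hl : |l| ≤ 1 / (2 * b)) :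
    Integrable (fun ω => Real.exp (l * (X ω - ∫ x, X x ∂μ))) μ := by
  refine ((h.integrable_exp hX).const_mul (Real.exp (-(l * ∫ x, X x ∂μ)))).mono'
    (by fun_prop) (.of_forall fun ω => ?_)
  rw [Real.norm_eq_abs, Real.abs_exp, mul_sub, sub_eq_neg_add, Real.exp_add]
  gcongr
  calc l * X ω ≤ |l| * |X ω| := (le_abs_self _).trans (abs_mul _ _).le
    _ ≤ 1 / b * |X ω| := by
        gcongr
        exact hl.trans (one_div_le_one_div_of_le hb (by linarith))
    _ = |X ω| / b := by ring

variable [IsProbabilityMeasure μ]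

lemma mgf_sub_integral_le (h : PsiOneLE X b μ) (hb : 0 < b) (hX : Measurable X) {l : ℝ}
    (hl : |l| ≤ 1 / (2 * b)) :
    mgf (fun ω => X ω - ∫ x, X x ∂μ) μ l ≤ Real.exp (16 * l ^ 2 * b ^ 2) := by
  set m := ∫ x, X x ∂μ
  have hlin : Integrable (fun ω => 1 + l * X ω) μ :=
    (integrable_const _).add ((h.integrable hb hX).const_mul l)
  have hquad : Integrable (fun ω => 8 * l ^ 2 * b ^ 2 * Real.exp (|X ω| / b)) μ :=
    (h.integrable_exp hX).const_mul _
  have hmgf : mgf X μ l ≤ Real.exp (l * m + 16 * l ^ 2 * b ^ 2) := by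
    calc mgf X μ l
        ≤ ∫ ω, (1 + l * X ω + 8 * l ^ 2 * b ^ 2 * Real.exp (|X ω| / b)) ∂μ :=
          integral_mono_of_nonneg (.of_forall fun _ => (Real.exp_pos _).le) (hlin.add hquad)
            (.of_forall fun ω => exp_mul_le_one_add_mul_add hb hl (X ω))
      _ = 1 + l * m + 8 * l ^ 2 * b ^ 2 * ∫ ω, Real.exp (|X ω| / b) ∂μ := by
          rw [integral_add hlin hquad,
            integral_add (integrable_const _) ((h.integrable hb hX).const_mul l),
            integral_const_mul, integral_const_mul, integral_const, probReal_univ, one_smul]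
      _ ≤ 1 + l * m + 8 * l ^ 2 * b ^ 2 * 2 := by
          gcongr
          exact h.integral_exp_le hX
      _ ≤ _ := by linarith [Real.add_one_le_exp (l * m + 16 * l ^ 2 * b ^ 2)]
  calc mgf (fun ω => X ω - m) μ l = mgf X μ l * Real.exp (l * -m) := by
        simp only [sub_eq_add_neg, mgf_add_const]
    _ ≤ Real.exp (l * m + 16 * l ^ 2 * b ^ 2) * Real.exp (l * -m) := by gcongr
    _ = _ := by rw [← Real.exp_add]; congr 1; ring

lemma measure_pi_sum_sub_integral_ge_le (h : PsiOneLE X b μ) (hb : 0 < b) (hX : Measurable X)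
    {t l : ℝ} (n : ℕ) (hl0 : 0 ≤ l) (hl : l ≤ 1 / (2 * b)) (hlt : 32 * b ^ 2 * l ≤ t) :
    Measure.pi (fun _ : Fin n => μ) {ω | n * t ≤ ∑ i, (X (ω i) - ∫ x, X x ∂μ)} ≤
      ENNReal.ofReal (Real.exp (-(l * t / 2 * n))) := by
  set m := ∫ x, X x ∂μ
  have hl' : |l| ≤ 1 / (2 * b) := by rwa [abs_of_nonneg hl0]
  have hYm (i : Fin n) : Measurable fun ω : Fin n → Ω => X (ω i) - m := by fun_prop
  have hindep : iIndepFun (fun i (ω : Fin n → Ω) => X (ω i) - m) (Measure.pi fun _ => μ) :=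
    iIndepFun_pi (μ := fun _ => μ) (X := fun _ x => X x - m) fun _ => by fun_prop
  have hpres (i : Fin n) := measurePreserving_eval (fun _ : Fin n => μ) i
  have hmgf (i : Fin n) : mgf (fun ω : Fin n → Ω => X (ω i) - m) (Measure.pi fun _ => μ) l ≤
      Real.exp (16 * l ^ 2 * b ^ 2) := by
    have hmap := mgf_map (μ := Measure.pi fun _ => μ) (X := fun x => X x - m) (t := l)
      (hpres i).measurable.aemeasurable (by fun_prop)
    rw [(hpres i).map_eq] at hmap
    exact hmap.symm.trans_le (h.mgf_sub_integral_le hb hX hl')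
  have hint (i : Fin n) : Integrable (fun ω : Fin n → Ω => Real.exp (l * (X (ω i) - m)))
      (Measure.pi fun _ => μ) :=
    (hpres i).integrable_comp_of_integrable (h.integrable_exp_mul_sub_integral hb hX hl')
  have hsum := hindep.integrable_exp_mul_sum hYm (s := Finset.univ) fun i _ => hint i
  have hChernoff := measure_ge_le_exp_mul_mgf (n * t) hl0 hsum
  rw [hindep.mgf_sum hYm] at hChernoff
  simp only [Finset.sum_apply] at hChernoff
  rw [← ofReal_measureReal]
  refine ENNReal.ofReal_le_ofReal (hChernoff.trans ?_)
  calc Real.exp (-l * (n * t)) * ∏ i : Fin n, mgf (fun ω : Fin n → Ω => X (ω i) - m) _ l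
      ≤ Real.exp (-l * (n * t)) * ∏ _i : Fin n, Real.exp (16 * l ^ 2 * b ^ 2) := by
        gcongr with i
        · exact fun _ _ => mgf_nonneg
        · exact hmgf i
    _ = Real.exp (-l * (n * t) + n * (16 * l ^ 2 * b ^ 2)) := by
        rw [Finset.prod_const, Finset.card_fin, ← Real.exp_nat_mul, ← Real.exp_add]
    _ ≤ _ := by
        have hquad : n * l * (32 * b ^ 2 * l) ≤ n * l * t := by gcongr
        exact Real.exp_le_exp.2 (by linarith)

lemma measure_pi_abs_average_sub_integral_ge_le (h : PsiOneLE X b μ) (hb : 0 < b)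
    (hX : Measurable X) {t : ℝ} (ht : 0 ≤ t) (n : ℕ) :
    Measure.pi (fun _ : Fin n => μ) {ω | t ≤ |(n : ℝ)⁻¹ * ∑ i, X (ω i) - ∫ x, X x ∂μ|} ≤
      ENNReal.ofReal (2 * Real.exp (-(bernsteinRate b t * n))) := by
  set l := min (t / (32 * b ^ 2)) (1 / (2 * b))
  have hl0 : 0 ≤ l := le_min (by positivity) (by positivity)
  have hlt : 32 * b ^ 2 * l ≤ t := by
    rw [mul_comm, ← le_div_iff₀ (by positivity)]
    exact min_le_left _ _
  have hupper := h.measure_pi_sum_sub_integral_ge_le hb hX n hl0 (min_le_right _ _) hlt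
  have hlower := h.neg.measure_pi_sum_sub_integral_ge_le hb hX.neg n hl0 (min_le_right _ _) hlt
  have hset : {ω : Fin n → Ω | t ≤ |(n : ℝ)⁻¹ * ∑ i, X (ω i) - ∫ x, X x ∂μ|} ⊆
      {ω | n * t ≤ ∑ i, (X (ω i) - ∫ x, X x ∂μ)} ∪
      {ω | n * t ≤ ∑ i, ((-X) (ω i) - ∫ x, (-X) x ∂μ)} := by
    intro ω hω
    have hsum : n * ((n : ℝ)⁻¹ * ∑ i, X (ω i) - ∫ x, X x ∂μ) = ∑ i, (X (ω i) - ∫ x, X x ∂μ) := by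
      rcases n.eq_zero_or_pos with rfl | hn
      · simp
      rw [mul_sub, mul_inv_cancel_left₀ (by positivity), Finset.sum_sub_distrib, Finset.sum_const,
        Finset.card_fin, nsmul_eq_mul]
    have habs : n * t ≤ |∑ i, (X (ω i) - ∫ x, X x ∂μ)| := by
      rw [← hsum, abs_mul, Nat.abs_cast]
      exact mul_le_mul_of_nonneg_left hω n.cast_nonneg
    refine (le_abs.1 habs).imp id fun hneg => ?_
    rw [← Finset.sum_neg_distrib] at hneg
    simp only [Set.mem_ofPred_eq, Pi.neg_apply, integral_neg]
    exact hneg.trans_eq (Finset.sum_congr rfl fun i _ => by ring)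
  refine (measure_mono hset).trans ((measure_union_le _ _).trans ((add_le_add hupper hlower).trans
    (le_of_eq ?_)))
  rw [← ENNReal.ofReal_add (Real.exp_pos _).le (Real.exp_pos _).le, two_mul, bernsteinRate]

end PsiOneLE

lemma bernsteinRate_pos {b t : ℝ} (hb : 0 < b) (ht : 0 < t) : 0 < bernsteinRate b t :=
  div_pos (mul_pos (lt_min (by positivity) (by positivity)) ht) two_pos

lemma psiOneLE_sq_gaussianReal {v : NNReal} {c : ℝ} (hc : 4 * (v : ℝ) ≤ c) :
    PsiOneLE (fun x => x ^ 2) c (gaussianReal 0 v) := by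
  simp only [PsiOneLE, abs_sq]
  rcases eq_or_ne v 0 with rfl | hv
  · simp [gaussianReal_zero_var]
  have : (0 : ℝ) < v := by exact_mod_cast pos_iff_ne_zero.2 hv
  have h2v : (2 * v : NNReal) ≠ 0 := by simpa using hv
  have hpdf (x : ℝ) : gaussianPDF 0 v x * ENNReal.ofReal (Real.exp (x ^ 2 / (4 * v))) =
      ENNReal.ofReal √2 * gaussianPDF 0 (2 * v) x := by
    have hsqrt : √(2 * Real.pi * ((2 * v : NNReal) : ℝ)) = √2 * √(2 * Real.pi * v) := by
      rw [← Real.sqrt_mul (by norm_num)]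
      congr 1
      push_cast
      ring
    rw [gaussianPDF, gaussianPDF, ← ENNReal.ofReal_mul (gaussianPDFReal_nonneg _ _ _),
      ← ENNReal.ofReal_mul (Real.sqrt_nonneg _), gaussianPDFReal, gaussianPDFReal, mul_assoc,
      ← Real.exp_add, ← mul_assoc, hsqrt, mul_inv, mul_inv_cancel_left₀ (by positivity)]
    congr 3
    push_cast
    field_simp
    ring
  calc ∫⁻ x, ENNReal.ofReal (Real.exp (x ^ 2 / c)) ∂(gaussianReal 0 v)
      ≤ ∫⁻ x, ENNReal.ofReal (Real.exp (x ^ 2 / (4 * v))) ∂(gaussianReal 0 v) := by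
        gcongr
    _ = ∫⁻ x, ENNReal.ofReal √2 * gaussianPDF 0 (2 * v) x := by
        rw [gaussianReal_of_var_ne_zero _ hv, lintegral_withDensity_eq_lintegral_mul _
          (measurable_gaussianPDF _ _) (by fun_prop)]
        exact lintegral_congr hpdf
    _ = ENNReal.ofReal √2 := by
        rw [lintegral_const_mul _ (measurable_gaussianPDF _ _),
          lintegral_gaussianPDF_eq_one _ h2v, mul_one]
    _ ≤ 2 := by
        rw [← ENNReal.ofReal_ofNat]
        exact ENNReal.ofReal_le_ofReal (by rw [Real.sqrt_le_left] <;> norm_num)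

/-! ### Nets of the unit ball -/

lemma measure_biUnion_finset_le_ofReal {Ω ι : Type*} [MeasurableSpace Ω] {μ : Measure Ω}
    {s : Finset ι} {A : ι → Set Ω} {k ε : ℝ} (hs : s.card ≤ k) (hε : 0 ≤ ε)
    (hA : ∀ i ∈ s, μ (A i) ≤ ENNReal.ofReal ε) :
    μ (⋃ i ∈ s, A i) ≤ ENNReal.ofReal (k * ε) := by
  calc μ (⋃ i ∈ s, A i) ≤ ∑ i ∈ s, μ (A i) := measure_biUnion_finset_le _ _
    _ ≤ ENNReal.ofReal (s.card * ε) := by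
        rw [← nsmul_eq_mul, ENNReal.ofReal_nsmul]
        exact Finset.sum_le_card_nsmul _ _ _ hA
    _ ≤ ENNReal.ofReal (k * ε) := by gcongr

/-- A finite `1/2`-net of the closed unit ball, by points of that ball. -/
structure IsHalfNet {E : Type*} [NormedAddCommGroup E] (N : Finset E) : Prop where
  norm_le_one : ∀ u ∈ N, ‖u‖ ≤ 1
  exists_norm_sub_le : ∀ u, ‖u‖ ≤ 1 → ∃ v ∈ N, ‖u - v‖ ≤ 1 / 2

section IsHalfNet

variable {E : Type*} [NormedAddCommGroup E] [NormedSpace ℝ E]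

lemma card_le_five_pow_of_separated [FiniteDimensional ℝ E] {s : Finset E}
    (hs : ∀ u ∈ s, ‖u‖ ≤ 1) (hsep : ∀ u ∈ s, ∀ v ∈ s, u ≠ v → 1 / 2 ≤ ‖u - v‖) :
    s.card ≤ 5 ^ Module.finrank ℝ E := by
  classical
  rw [← Finset.card_image_of_injective s (smul_right_injective E (two_ne_zero (α := ℝ)))]
  refine Besicovitch.card_le_of_separated _ ?_ ?_
  · simp only [Finset.forall_mem_image, norm_smul, Real.norm_ofNat]
    intro u hu
    linarith [hs u hu]
  · simp only [Finset.forall_mem_image, ← smul_sub, norm_smul, Real.norm_ofNat]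
    intro u hu v hv huv
    linarith [hsep u hu v hv (ne_of_apply_ne _ huv)]

/-- A separated subset of the ball of maximal cardinality is a net. -/
lemma exists_isHalfNet (E : Type*) [NormedAddCommGroup E] [NormedSpace ℝ E]
    [FiniteDimensional ℝ E] :
    ∃ N : Finset E, IsHalfNet N ∧ N.card ≤ 5 ^ Module.finrank ℝ E := by
  classical
  let P : Set (Finset E) := {s | (∀ u ∈ s, ‖u‖ ≤ 1) ∧ (s : Set E).Pairwise (1 / 2 ≤ ‖· - ·‖)}
  have hcard : ∀ s ∈ P, s.card ≤ 5 ^ Module.finrank ℝ E :=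
    fun s hs => card_le_five_pow_of_separated hs.1 fun _ hu _ hv => hs.2 hu hv
  have hbdd : BddAbove (Finset.card '' P) :=
    ⟨_, by rintro _ ⟨s, hs, rfl⟩; exact hcard s hs⟩
  have hne : P.Nonempty := ⟨∅, by simp [P]⟩
  obtain ⟨s, hs, hmax⟩ := Nat.sSup_mem (hne.image _) hbdd
  refine ⟨s, ⟨hs.1, fun u hu => ?_⟩, hcard s hs⟩
  by_contra! hfar
  have hus : u ∉ s := fun h => by simpa using (hfar u h).trans_le' (by norm_num : (0 : ℝ) ≤ 1 / 2)
  have hins : insert u s ∈ P := by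
    refine ⟨by simpa using ⟨hu, hs.1⟩, ?_⟩
    rw [Finset.coe_insert, Set.pairwise_insert]
    exact ⟨hs.2, fun v hv _ => ⟨(hfar v hv).le, norm_sub_rev u v ▸ (hfar v hv).le⟩⟩
  have hle : (insert u s).card ≤ s.card := hmax ▸ le_csSup hbdd ⟨_, hins, rfl⟩
  rw [Finset.card_insert_of_notMem hus] at hle
  omega

variable {N : Finset E}

lemma IsHalfNet.norm_le_two_mul (hN : IsHalfNet N) (F : E →L[ℝ] ℝ) {δ : ℝ}
    (h : ∀ v ∈ N, |F v| ≤ δ) : ‖F‖ ≤ 2 * δ := by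
  have hδ : 0 ≤ δ := by
    obtain ⟨v, hv, -⟩ := hN.exists_norm_sub_le 0 (by simp)
    exact (abs_nonneg _).trans (h v hv)
  have hself : ‖F‖ ≤ δ + ‖F‖ / 2 := by
    refine F.opNorm_le_of_unit_norm (by positivity) fun u hu => ?_
    obtain ⟨v, hv, huv⟩ := hN.exists_norm_sub_le u hu.le
    calc ‖F u‖ = ‖F v + F (u - v)‖ := by rw [← map_add, add_sub_cancel]
      _ ≤ δ + ‖F‖ * (1 / 2) :=
          (norm_add_le _ _).trans (add_le_add (h v hv) (F.le_opNorm_of_le huv))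
      _ = δ + ‖F‖ / 2 := by ring
  linarith

variable [FiniteDimensional ℝ E]

lemma IsHalfNet.abs_le (hN : IsHalfNet N) (f : E →ₗ[ℝ] ℝ) {δ : ℝ}
    (h : ∀ v ∈ N, |f v| ≤ δ) (u : E) : |f u| ≤ 2 * δ * ‖u‖ :=
  f.toContinuousLinearMap.le_of_opNorm_le (hN.norm_le_two_mul f.toContinuousLinearMap h) u

lemma IsHalfNet.abs_bilin_le (hN : IsHalfNet N) (B : E →ₗ[ℝ] E →ₗ[ℝ] ℝ) {δ : ℝ}
    (h : ∀ u ∈ N, ∀ v ∈ N, |B u v| ≤ δ) (u v : E) : |B u v| ≤ 4 * δ * ‖u‖ * ‖v‖ := by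
  have hu : ∀ w ∈ N, |B u w| ≤ 2 * δ * ‖u‖ := fun w hw =>
    hN.abs_le (B.flip w) (fun z hz => h z hz w hw) u
  exact (hN.abs_le (B u) hu v).trans_eq (by ring)

end IsHalfNet

/-! ### Matrices acting on Euclidean space -/

section Act

variable {d : ℕ}

lemma act_mul (M N : Matrix (Fin d) (Fin d) ℝ) (v : Vec d) : act (M * N) v = act M (act N v) := by
  simp [act]

lemma act_one (v : Vec d) : act 1 v = v := by
  simp [act]

lemma act_add (M : Matrix (Fin d) (Fin d) ℝ) (u v : Vec d) : act M (u + v) = act M u + act M v :=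
  map_add _ _ _

lemma act_sub (M : Matrix (Fin d) (Fin d) ℝ) (u v : Vec d) : act M (u - v) = act M u - act M v :=
  map_sub _ _ _

lemma act_smul (M : Matrix (Fin d) (Fin d) ℝ) (c : ℝ) (v : Vec d) : act M (c • v) = c • act M v :=
  map_smul _ _ _

lemma add_act (M N : Matrix (Fin d) (Fin d) ℝ) (v : Vec d) : act (M + N) v = act M v + act N v := by
  simp [act]

lemma opNorm_nonneg (M : Matrix (Fin d) (Fin d) ℝ) : 0 ≤ opNorm M := norm_nonneg _

lemma norm_act_le (M : Matrix (Fin d) (Fin d) ℝ) (v : Vec d) : ‖act M v‖ ≤ opNorm M * ‖v‖ :=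
  ContinuousLinearMap.le_opNorm _ _

lemma inner_act_le (M : Matrix (Fin d) (Fin d) ℝ) (v : Vec d) :
    inner ℝ v (act M v) ≤ opNorm M * ‖v‖ ^ 2 := by
  calc inner ℝ v (act M v) ≤ ‖v‖ * ‖act M v‖ := real_inner_le_norm _ _
    _ ≤ ‖v‖ * (opNorm M * ‖v‖) := by gcongr; exact norm_act_le _ _
    _ = opNorm M * ‖v‖ ^ 2 := by ring

lemma inner_act (M : Matrix (Fin d) (Fin d) ℝ) (u v : Vec d) :
    inner ℝ u (act M v) = ∑ i, ∑ j, M i j * (u i * v j) := by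
  rw [act, Matrix.inner_toEuclideanCLM, dotProduct]
  refine Finset.sum_congr rfl fun i _ => ?_
  rw [Matrix.mulVec, dotProduct, Finset.mul_sum]
  exact Finset.sum_congr rfl fun j _ => by ring

lemma inner_act_transpose (M : Matrix (Fin d) (Fin d) ℝ) (u v : Vec d) :
    inner ℝ (act Mᵀ u) v = inner ℝ u (act M v) := by
  rw [real_inner_comm v, inner_act, inner_act, Finset.sum_comm]
  refine Finset.sum_congr rfl fun i _ => Finset.sum_congr rfl fun j _ => ?_
  rw [Matrix.transpose_apply, mul_comm (v j)]

lemma posDef_iff_inner_act {M : Matrix (Fin d) (Fin d) ℝ} :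
    M.PosDef ↔ Mᵀ = M ∧ ∀ v : Vec d, v ≠ 0 → 0 < inner ℝ v (act M v) := by
  rw [Matrix.posDef_iff_dotProduct_mulVec]
  refine and_congr (by rw [Matrix.IsHermitian, Matrix.conjTranspose_eq_transpose_of_trivial])
    ⟨fun h v hv => ?_, fun h x hx => ?_⟩
  · rw [act, Matrix.inner_toEuclideanCLM]
    simpa using h (x := WithLp.ofLp v) (by simpa using hv)
  · have := h (WithLp.toLp 2 x) (by simpa using hx)
    rw [act, Matrix.inner_toEuclideanCLM] at this
    simpa using this

section Moments

variable {n : ℕ} (D : Dataset n d)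

lemma inner_secondMoment (u v : Vec d) :
    inner ℝ u (act (secondMoment D) v) =
      (n : ℝ)⁻¹ * ∑ i, inner ℝ u (D i).1 * inner ℝ v (D i).1 := by
  rw [inner_act]
  simp only [secondMoment_apply, PiLp.inner_apply, RCLike.inner_apply, conj_trivial,
    Finset.mul_sum, Finset.sum_mul]
  rw [Finset.sum_congr rfl fun _ _ => Finset.sum_comm, Finset.sum_comm]
  refine Finset.sum_congr rfl fun i _ => ?_
  rw [Finset.sum_comm]
  exact Finset.sum_congr rfl fun j _ => Finset.sum_congr rfl fun k _ => by ring

lemma inner_crossMoment (u : Vec d) :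
    inner ℝ u (crossMoment D) = (n : ℝ)⁻¹ * ∑ i, inner ℝ u (D i).1 * (D i).2 := by
  simp only [PiLp.inner_apply, RCLike.inner_apply, conj_trivial, crossMoment_apply,
    Finset.mul_sum, Finset.sum_mul]
  rw [Finset.sum_comm]
  exact Finset.sum_congr rfl fun i _ => Finset.sum_congr rfl fun j _ => by ring

lemma transpose_secondMoment : (secondMoment D)ᵀ = secondMoment D := by
  ext i j
  exact secondMoment_comm D j i

lemma responseScale_sq : responseScale D ^ 2 = (n : ℝ)⁻¹ * ∑ i, (D i).2 ^ 2 :=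
  Real.sq_sqrt (by positivity)

end Moments

section Sqrt

variable {S : Matrix (Fin d) (Fin d) ℝ}

lemma transpose_sqrt (S : Matrix (Fin d) (Fin d) ℝ) : (CFC.sqrt S)ᵀ = CFC.sqrt S := by
  rw [← Matrix.conjTranspose_eq_transpose_of_trivial]
  exact (Matrix.nonneg_iff_posSemidef.1 (CFC.sqrt_nonneg S)).isHermitian

lemma transpose_invSqrt (S : Matrix (Fin d) (Fin d) ℝ) : (invSqrt S)ᵀ = invSqrt S := by
  rw [invSqrt, Matrix.transpose_nonsing_inv, transpose_sqrt S]

lemma inner_act_invSqrt (S : Matrix (Fin d) (Fin d) ℝ) (u v : Vec d) :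
    inner ℝ u (act (invSqrt S) v) = inner ℝ (act (invSqrt S) u) v := by
  rw [← inner_act_transpose, transpose_invSqrt S]

lemma sqrt_mul_sqrt (hS : S.PosDef) : CFC.sqrt S * CFC.sqrt S = S :=
  CFC.sqrt_mul_sqrt_self S (Matrix.nonneg_iff_posSemidef.2 hS.posSemidef)

lemma isUnit_det_sqrt (hS : S.PosDef) : IsUnit (CFC.sqrt S).det := by
  refine isUnit_of_mul_isUnit_left (y := (CFC.sqrt S).det) ?_
  rw [← Matrix.det_mul, sqrt_mul_sqrt hS]
  exact hS.det_pos.ne'.isUnit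

lemma invSqrt_mul_invSqrt (hS : S.PosDef) : invSqrt S * invSqrt S = S⁻¹ := by
  rw [invSqrt, ← Matrix.mul_inv_rev, sqrt_mul_sqrt hS]

lemma act_invSqrt_act_sqrt (hS : S.PosDef) (v : Vec d) :
    act (invSqrt S) (act (CFC.sqrt S) v) = v := by
  rw [← act_mul, invSqrt, Matrix.nonsing_inv_mul _ (isUnit_det_sqrt hS), act_one]

lemma act_sqrt_act_invSqrt (hS : S.PosDef) (v : Vec d) :
    act (CFC.sqrt S) (act (invSqrt S) v) = v := by
  rw [← act_mul, invSqrt, Matrix.mul_nonsing_inv _ (isUnit_det_sqrt hS), act_one]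

lemma inner_act_eq_inner_sqrt (hS : S.PosDef) (u v : Vec d) :
    inner ℝ u (act S v) = inner ℝ (act (CFC.sqrt S) u) (act (CFC.sqrt S) v) := by
  conv_lhs => rw [← sqrt_mul_sqrt hS, act_mul, ← inner_act_transpose, transpose_sqrt S]

lemma inner_act_self (hS : S.PosDef) (v : Vec d) :
    inner ℝ v (act S v) = ‖act (CFC.sqrt S) v‖ ^ 2 := by
  rw [inner_act_eq_inner_sqrt hS, real_inner_self_eq_norm_sq]

lemma inner_act_self_nonneg (hS : S.PosDef) (v : Vec d) : 0 ≤ inner ℝ v (act S v) := by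
  rw [inner_act_self hS]
  positivity

lemma inner_invSqrt_act (hS : S.PosDef) (u v : Vec d) :
    inner ℝ (act (invSqrt S) u) (act S (act (invSqrt S) v)) = inner ℝ u v := by
  rw [inner_act_eq_inner_sqrt hS, act_sqrt_act_invSqrt hS, act_sqrt_act_invSqrt hS]

lemma opNorm_invSqrt_sq (hS : S.PosDef) : opNorm (invSqrt S) ^ 2 = opNorm S⁻¹ := by
  have hself : IsSelfAdjoint (Matrix.toEuclideanCLM (𝕜 := ℝ) (invSqrt S)) := by
    rw [IsSelfAdjoint, ← map_star, Matrix.star_eq_conjTranspose,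
      Matrix.conjTranspose_eq_transpose_of_trivial, transpose_invSqrt]
  rw [opNorm, opNorm, ← invSqrt_mul_invSqrt hS, map_mul, hself.norm_mul_self]

end Sqrt

end Act

/-! ### Moments of a sample -/

/-- The second moment `E y²` of a response `y = ⟨x, β⟩ + ε`. -/
def responseVar {d : ℕ} (S : Matrix (Fin d) (Fin d) ℝ) (β : Vec d) (σ : ℝ) : ℝ :=
  inner ℝ β (act S β) + σ ^ 2

lemma integral_add_sq_prod {Ω Ω' : Type*} [MeasurableSpace Ω] [MeasurableSpace Ω']
    {μ : Measure Ω} {ν : Measure Ω'} [IsProbabilityMeasure μ] [IsProbabilityMeasure ν]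
    {f : Ω → ℝ} {g : Ω' → ℝ} (hf : MemLp f 2 μ) (hg : MemLp g 2 ν) (hg0 : ∫ y, g y ∂ν = 0) :
    ∫ p, (f p.1 + g p.2) ^ 2 ∂(μ.prod ν) = ∫ x, f x ^ 2 ∂μ + ∫ y, g y ^ 2 ∂ν := by
  have hff : Integrable (fun p : Ω × Ω' => f p.1 ^ 2) (μ.prod ν) := hf.integrable_sq.comp_fst ν
  have hfg : Integrable (fun p : Ω × Ω' => 2 * (f p.1 * g p.2)) (μ.prod ν) :=
    ((hf.integrable one_le_two).mul_prod (hg.integrable one_le_two)).const_mul 2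
  have hgg : Integrable (fun p : Ω × Ω' => g p.2 ^ 2) (μ.prod ν) := hg.integrable_sq.comp_snd μ
  calc ∫ p, (f p.1 + g p.2) ^ 2 ∂(μ.prod ν)
      = ∫ p, (f p.1 ^ 2 + 2 * (f p.1 * g p.2) + g p.2 ^ 2) ∂(μ.prod ν) := by
        simp only [add_sq, mul_assoc]
    _ = ∫ p, f p.1 ^ 2 ∂(μ.prod ν) + 2 * ∫ p, f p.1 * g p.2 ∂(μ.prod ν) +
          ∫ p, g p.2 ^ 2 ∂(μ.prod ν) := by
        rw [integral_add (f := fun p : Ω × Ω' => f p.1 ^ 2 + 2 * (f p.1 * g p.2)) (hff.add hfg) hgg,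
          integral_add hff hfg, integral_const_mul]
    _ = ∫ x, f x ^ 2 ∂μ + ∫ y, g y ^ 2 ∂ν := by
        rw [integral_prod_mul f g, hg0, integral_fun_fst (fun x => f x ^ 2),
          integral_fun_snd (fun y => g y ^ 2)]
        simp only [probReal_univ, one_smul, mul_zero, add_zero]

lemma integral_sq_gaussianReal_zero (v : NNReal) : ∫ e, e ^ 2 ∂(gaussianReal 0 v) = v := by
  have h := variance_fun_id_gaussianReal (μ := 0) (v := v)
  rw [variance_eq_integral (by fun_prop), integral_id_gaussianReal] at h
  simpa using h

section Sample

variable {d : ℕ} {ν : Measure (Vec d)}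

lemma measurable_sample (β : Vec d) :
    Measurable fun p : Vec d × ℝ => (p.1, inner ℝ p.1 β + p.2) := by fun_prop

lemma measurePreserving_sample (ν : Measure (Vec d)) (β : Vec d) (σ : ℝ) :
    MeasurePreserving (fun p => (p.1, inner ℝ p.1 β + p.2))
      (ν.prod (gaussianReal 0 (σ ^ 2).toNNReal)) (sampleLaw ν β σ) :=
  ⟨measurable_sample β, rfl⟩

instance isProbabilityMeasure_sampleLaw [IsProbabilityMeasure ν] (β : Vec d) (σ : ℝ) :
    IsProbabilityMeasure (sampleLaw ν β σ) :=
  Measure.isProbabilityMeasure_map (measurable_sample β).aemeasurable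

lemma measurePreserving_fst_sampleLaw (ν : Measure (Vec d)) (β : Vec d) (σ : ℝ) :
    MeasurePreserving Prod.fst (sampleLaw ν β σ) ν := by
  refine ⟨measurable_fst, ?_⟩
  rw [sampleLaw, Measure.map_map measurable_fst (measurable_sample β)]
  exact Measure.map_fst_prod.trans (by rw [measure_univ, one_smul])

namespace IsSubG

variable {S : Matrix (Fin d) (Fin d) ℝ} {K : ℝ}

lemma responseVar_nonneg (hν : IsSubG ν S K) (β : Vec d) (σ : ℝ) : 0 ≤ responseVar S β σ :=
  add_nonneg (inner_act_self_nonneg hν.posDef β) (sq_nonneg σ)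

lemma responseVar_pos (hν : IsSubG ν S K) {β : Vec d} {σ : ℝ} (h : β ≠ 0 ∨ σ ≠ 0) :
    0 < responseVar S β σ := by
  rcases h with hβ | hσ
  · exact add_pos_of_pos_of_nonneg ((posDef_iff_inner_act.1 hν.posDef).2 β hβ) (sq_nonneg σ)
  · exact add_pos_of_nonneg_of_pos (inner_act_self_nonneg hν.posDef β) (by positivity)

lemma psiOneLE_inner_sq (hν : IsSubG ν S K) (hK : 0 < K) (v : Vec d) {c : ℝ}
    (hc : K ^ 2 * inner ℝ v (act S v) ≤ c) : PsiOneLE (fun x => inner ℝ v x ^ 2) c ν := by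
  have := hν.isProbabilityMeasure
  rcases eq_or_ne v 0 with rfl | hv
  · simp [PsiOneLE]
  refine le_trans (lintegral_mono fun x => ?_) (hν.psiTwo_le v)
  have hpos : 0 < inner ℝ v (act S v) := (posDef_iff_inner_act.1 hν.posDef).2 v hv
  rw [abs_sq]
  exact ENNReal.ofReal_le_ofReal (Real.exp_le_exp.2 (by gcongr))

lemma psiOneLE_inner_mul_inner (hν : IsSubG ν S K) (hK : 0 < K) {u v : Vec d} {c : ℝ}
    (hu : K ^ 2 * inner ℝ u (act S u) ≤ c) (hv : K ^ 2 * inner ℝ v (act S v) ≤ c) :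
    PsiOneLE (fun x => inner ℝ u x * inner ℝ v x) c ν := by
  have hc : 0 ≤ c := (mul_nonneg (sq_nonneg K) (inner_act_self_nonneg hν.posDef u)).trans hu
  refine .of_abs_le_half_add (hν.psiOneLE_inner_sq hK u hu) (hν.psiOneLE_inner_sq hK v hv)
    (by fun_prop) (by fun_prop) fun x => ?_
  rw [← add_div, div_right_comm, abs_sq, abs_sq, abs_mul, ← sq_abs (inner ℝ u x),
    ← sq_abs (inner ℝ v x)]
  gcongr
  linarith [two_mul_le_add_sq |inner ℝ u x| |inner ℝ v x|]

lemma integrable_inner_mul_inner_and_integral_eq (hν : IsSubG ν S K) (u v : Vec d) :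
    Integrable (fun x => inner ℝ u x * inner ℝ v x) ν ∧
      ∫ x, inner ℝ u x * inner ℝ v x ∂ν = inner ℝ u (act S v) := by
  have hexp (x : Vec d) : inner ℝ u x * inner ℝ v x = ∑ i, ∑ j, u i * v j * (x i * x j) := by
    simp only [PiLp.inner_apply, RCLike.inner_apply, conj_trivial, Finset.sum_mul_sum]
    exact Finset.sum_congr rfl fun i _ => Finset.sum_congr rfl fun j _ => by ring
  have hint (i j) : Integrable (fun x : Vec d => u i * v j * (x i * x j)) ν :=
    (hν.integrable i j).const_mul _
  have hsum (i) : Integrable (fun x : Vec d => ∑ j, u i * v j * (x i * x j)) ν :=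
    integrable_finsetSum _ fun j _ => hint i j
  simp only [hexp]
  refine ⟨integrable_finsetSum _ fun i _ => hsum i, ?_⟩
  rw [integral_finsetSum _ fun i _ => hsum i, inner_act]
  refine Finset.sum_congr rfl fun i _ => ?_
  rw [integral_finsetSum _ fun j _ => hint i j]
  refine Finset.sum_congr rfl fun j _ => ?_
  rw [integral_const_mul, hν.secondMoment_eq, mul_comm]

lemma psiOneLE_response_sq (hν : IsSubG ν S K) (hK : 0 < K) (β : Vec d) (σ : ℝ) :
    PsiOneLE (fun p => p.2 ^ 2) ((4 * K ^ 2 + 16) * responseVar S β σ) (sampleLaw ν β σ) := by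
  have := hν.isProbabilityMeasure
  have hq := inner_act_self_nonneg hν.posDef β
  set c := (4 * K ^ 2 + 16) * responseVar S β σ with hc
  have hc0 : 0 ≤ c := mul_nonneg (by positivity) (hν.responseVar_nonneg β σ)
  have hKq := mul_nonneg (sq_nonneg K) hq
  have hKσ := mul_nonneg (sq_nonneg K) (sq_nonneg σ)
  have hsignal : PsiOneLE (fun x => inner ℝ β x ^ 2) (c / 4) ν :=
    hν.psiOneLE_inner_sq hK β (by rw [hc, responseVar]; linarith [sq_nonneg σ])
  have hnoise : PsiOneLE (fun e => e ^ 2) (c / 4) (gaussianReal 0 (σ ^ 2).toNNReal) :=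
    psiOneLE_sq_gaussianReal (by
      rw [Real.coe_toNNReal _ (sq_nonneg σ), hc, responseVar]
      linarith)
  rw [← PsiOneLE.comp_iff (measurePreserving_sample ν β σ) (by fun_prop)]
  refine .of_abs_le_half_add
    ((PsiOneLE.comp_iff measurePreserving_fst (by fun_prop)).2 hsignal)
    ((PsiOneLE.comp_iff measurePreserving_snd (by fun_prop)).2 hnoise)
    (by fun_prop) (by fun_prop) fun p => ?_
  have hsq : (inner ℝ p.1 β + p.2) ^ 2 ≤ 2 * (inner ℝ β p.1 ^ 2 + p.2 ^ 2) := by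
    rw [real_inner_comm]
    exact add_sq_le
  simp only [abs_sq]
  calc (inner ℝ p.1 β + p.2) ^ 2 / c ≤ 2 * (inner ℝ β p.1 ^ 2 + p.2 ^ 2) / c := by gcongr
    _ = (inner ℝ β p.1 ^ 2 / (c / 4) + p.2 ^ 2 / (c / 4)) / 2 := by
        rw [div_div_eq_mul_div, div_div_eq_mul_div]
        ring

lemma integral_response_sq (hν : IsSubG ν S K) (β : Vec d) (σ : ℝ) :
    ∫ p, p.2 ^ 2 ∂(sampleLaw ν β σ) = responseVar S β σ := by
  have := hν.isProbabilityMeasure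
  obtain ⟨hint, hintegral⟩ := hν.integrable_inner_mul_inner_and_integral_eq β β
  simp only [← sq] at hint hintegral
  have hmem : MemLp (fun x : Vec d => inner ℝ β x) 2 ν :=
    (memLp_two_iff_integrable_sq (by fun_prop)).2 hint
  rw [← (measurePreserving_sample ν β σ).map_eq,
    integral_map (measurable_sample β).aemeasurable (by fun_prop)]
  simp only [real_inner_comm β]
  rw [integral_add_sq_prod (g := fun e => e) hmem (memLp_id_gaussianReal 2)
    integral_id_gaussianReal, hintegral, integral_sq_gaussianReal_zero,
    Real.coe_toNNReal _ (sq_nonneg σ), responseVar]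

end IsSubG

end Sample

/-! ### Concentration of the empirical moments -/

/-- The empirical second moment agrees with `S`, as a quadratic form, up to a factor `1 ± 1/2`. -/
def MomentClose {n d : ℕ} (S : Matrix (Fin d) (Fin d) ℝ) (D : Dataset n d) : Prop :=
  ∀ w : Vec d, |inner ℝ w (act (secondMoment D) w) - inner ℝ w (act S w)| ≤
    inner ℝ w (act S w) / 2

/-- The mean square of the responses agrees with `v` up to a factor `1 ± 1/2`. -/
def ResponseClose {n d : ℕ} (v : ℝ) (D : Dataset n d) : Prop :=
  |responseScale D ^ 2 - v| ≤ v / 2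

/-- All whitened features and all responses are bounded, up to a logarithmic factor, by the
square roots of their second moments. -/
def SampleBounded {n d : ℕ} (S : Matrix (Fin d) (Fin d) ℝ) (K v η : ℝ) (D : Dataset n d) : Prop :=
  ∀ i, ‖act (invSqrt S) (D i).1‖ ^ 2 ≤ 2 * K ^ 2 * d * Real.log (2 * n / η) ∧
    (D i).2 ^ 2 ≤ 2 * (4 * K ^ 2 + 16) * v * Real.log (2 * n / η)

lemma PsiOneLE.measure_pi_exists_ge_le {Ω : Type*} [MeasurableSpace Ω] {μ : Measure Ω}
    [IsProbabilityMeasure μ] {X : Ω → ℝ} {b : ℝ} (h : PsiOneLE X b μ) (hb : 0 < b)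
    (hX : Measurable X) {n : ℕ} (hn : 0 < n) {η : ℝ} (hη : 0 < η) :
    Measure.pi (fun _ : Fin n => μ) {ω | ∃ i, 2 * b * Real.log (2 * n / η) ≤ |X (ω i)|} ≤
      ENNReal.ofReal (η ^ 2 / (2 * n)) := by
  have hone (i : Fin n) : Measure.pi (fun _ : Fin n => μ)
      {ω | 2 * b * Real.log (2 * n / η) ≤ |X (ω i)|} ≤
        ENNReal.ofReal (2 * (2 * n / η) ^ (-2 : ℝ)) := by
    refine ((measurePreserving_eval (fun _ : Fin n => μ) i).measure_preimage
      (measurableSet_le measurable_const hX.abs).nullMeasurableSet).trans_le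
        ((h.measure_ge_le hb hX _).trans (le_of_eq ?_))
    rw [Real.rpow_def_of_pos (by positivity)]
    congr 3
    field_simp
  have hset : {ω : Fin n → Ω | ∃ i, 2 * b * Real.log (2 * n / η) ≤ |X (ω i)|} =
      ⋃ i ∈ (Finset.univ : Finset (Fin n)), {ω | 2 * b * Real.log (2 * n / η) ≤ |X (ω i)|} := by
    ext ω
    simp
  rw [hset]
  refine (measure_biUnion_finset_le_ofReal (k := n) (by simp) (by positivity)
    fun i _ => hone i).trans_eq (congrArg ENNReal.ofReal ?_)
  rw [Real.rpow_neg (by positivity), Real.rpow_two]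
  field_simp

lemma norm_sq_le_card_mul {d : ℕ} {v : Vec d} {c : ℝ} (h : ∀ j, v j ^ 2 ≤ c) : ‖v‖ ^ 2 ≤ d * c := by
  rw [EuclideanSpace.real_norm_sq_eq]
  exact (Finset.sum_le_card_nsmul _ _ _ fun j _ => h j).trans_eq (by simp)

section Concentration

variable {d : ℕ} {ν : Measure (Vec d)} {S : Matrix (Fin d) (Fin d) ℝ} {K : ℝ}

lemma momentClose_of_isHalfNet (hS : S.PosDef) {N : Finset (Vec d)} (hN : IsHalfNet N) {n : ℕ}
    {D : Dataset n d}
    (h : ∀ u ∈ N, ∀ v ∈ N, |inner ℝ (act (invSqrt S) u) (act (secondMoment D)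
      (act (invSqrt S) v)) - inner ℝ u v| ≤ 1 / 8) : MomentClose S D := by
  intro w
  let B : Vec d →ₗ[ℝ] Vec d →ₗ[ℝ] ℝ := LinearMap.mk₂ ℝ
    (fun u v => inner ℝ (act (invSqrt S) u) (act (secondMoment D) (act (invSqrt S) v)) -
      inner ℝ u v)
    (fun a b c => by simp only [act_add, inner_add_left]; ring)
    (fun a b c => by simp only [act_smul, real_inner_smul_left, smul_eq_mul]; ring)
    (fun a b c => by simp only [act_add, inner_add_right]; ring)
    (fun a b c => by simp only [act_smul, real_inner_smul_right, smul_eq_mul]; ring)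
  have hB := hN.abs_bilin_le B h (act (CFC.sqrt S) w) (act (CFC.sqrt S) w)
  simp only [B, LinearMap.mk₂_apply, act_invSqrt_act_sqrt hS] at hB
  rw [← inner_act_eq_inner_sqrt hS] at hB
  refine hB.trans_eq ?_
  rw [inner_act_self hS]
  ring

namespace IsSubG

lemma psiOneLE_inner_invSqrt_mul (hν : IsSubG ν S K) (hK : 0 < K) {u v : Vec d} (hu : ‖u‖ ≤ 1)
    (hv : ‖v‖ ≤ 1) :
    PsiOneLE (fun x => inner ℝ (act (invSqrt S) u) x * inner ℝ (act (invSqrt S) v) x)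
      (K ^ 2) ν := by
  have hle {w : Vec d} (hw : ‖w‖ ≤ 1) :
      K ^ 2 * inner ℝ (act (invSqrt S) w) (act S (act (invSqrt S) w)) ≤ K ^ 2 := by
    rw [inner_invSqrt_act hν.posDef, real_inner_self_eq_norm_sq]
    exact mul_le_of_le_one_right (sq_nonneg K) (pow_le_one₀ (norm_nonneg w) hw)
  exact hν.psiOneLE_inner_mul_inner hK (hle hu) (hle hv)

variable {μ : Measure (Vec d × ℝ)} [IsProbabilityMeasure μ]

lemma measure_abs_inner_secondMoment_sub_ge_le (hν : IsSubG ν S K) (hK : 0 < K)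
    (hμ : MeasurePreserving Prod.fst μ ν) {u v : Vec d} (hu : ‖u‖ ≤ 1) (hv : ‖v‖ ≤ 1) {t : ℝ}
    (ht : 0 ≤ t) (n : ℕ) :
    Measure.pi (fun _ : Fin n => μ) {D : Dataset n d | t ≤ |inner ℝ (act (invSqrt S) u)
        (act (secondMoment D) (act (invSqrt S) v)) - inner ℝ u v|} ≤
      ENNReal.ofReal (2 * Real.exp (-(bernsteinRate (K ^ 2) t * n))) := by
  have hmean := (hν.integrable_inner_mul_inner_and_integral_eq
    (act (invSqrt S) u) (act (invSqrt S) v)).2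
  rw [inner_invSqrt_act hν.posDef, ← hμ.map_eq,
    integral_map measurable_fst.aemeasurable (by fun_prop)] at hmean
  simp only [inner_secondMoment, ← hmean]
  exact ((PsiOneLE.comp_iff hμ (by fun_prop)).2
    (hν.psiOneLE_inner_invSqrt_mul hK hu hv)).measure_pi_abs_average_sub_integral_ge_le
      (by positivity) (by fun_prop) ht n

lemma measure_not_momentClose_le (hν : IsSubG ν S K) (hK : 0 < K)
    (hμ : MeasurePreserving Prod.fst μ ν) (n : ℕ) :
    Measure.pi (fun _ : Fin n => μ) {D : Dataset n d | ¬ MomentClose S D} ≤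
      ENNReal.ofReal (25 ^ d * (2 * Real.exp (-(bernsteinRate (K ^ 2) (1 / 8) * n)))) := by
  obtain ⟨N, hN, hcard⟩ := exists_isHalfNet (Vec d)
  rw [finrank_euclideanSpace_fin] at hcard
  have hcard2 : ((N ×ˢ N).card : ℝ) ≤ 25 ^ d := by
    rw [Finset.card_product, show (25 : ℝ) ^ d = 5 ^ d * 5 ^ d by rw [← mul_pow]; norm_num]
    exact_mod_cast Nat.mul_le_mul hcard hcard
  have hsub : {D : Dataset n d | ¬ MomentClose S D} ⊆ ⋃ p ∈ N ×ˢ N,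
      {D : Dataset n d | 1 / 8 ≤ |inner ℝ (act (invSqrt S) p.1)
        (act (secondMoment D) (act (invSqrt S) p.2)) - inner ℝ p.1 p.2|} := by
    intro D hD
    by_contra hfar
    simp only [Set.mem_iUnion, Set.mem_ofPred_eq, not_exists, not_le] at hfar
    exact hD (momentClose_of_isHalfNet hν.posDef hN fun u hu v hv =>
      (hfar (u, v) (Finset.mk_mem_product hu hv)).le)
  refine (measure_mono hsub).trans
    (measure_biUnion_finset_le_ofReal hcard2 (by positivity) fun p hp => ?_)
  obtain ⟨hp1, hp2⟩ := Finset.mem_product.1 hp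
  exact hν.measure_abs_inner_secondMoment_sub_ge_le hK hμ (hN.norm_le_one _ hp1)
    (hN.norm_le_one _ hp2) (by norm_num) n

lemma measure_not_responseClose_le (hν : IsSubG ν S K) (hK : 0 < K) (β : Vec d) (σ : ℝ)
    (hv : 0 < responseVar S β σ) (n : ℕ) :
    Measure.pi (fun _ : Fin n => sampleLaw ν β σ)
        {D : Dataset n d | ¬ ResponseClose (responseVar S β σ) D} ≤
      ENNReal.ofReal (2 * Real.exp (-(bernsteinRate (4 * K ^ 2 + 16) (1 / 2) * n))) := by
  have := hν.isProbabilityMeasure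
  set v := responseVar S β σ with hv_def
  have hpsi : PsiOneLE (fun p => p.2 ^ 2 / v) (4 * K ^ 2 + 16) (sampleLaw ν β σ) := by
    refine le_of_eq_of_le (lintegral_congr fun p => ?_) (hν.psiOneLE_response_sq hK β σ)
    rw [abs_div, abs_of_pos hv, div_div, mul_comm v]
  have h := hpsi.measure_pi_abs_average_sub_integral_ge_le (by positivity) (by fun_prop)
    (t := 1 / 2) (by norm_num) n
  rw [integral_div, hν.integral_response_sq, ← hv_def, div_self hv.ne'] at h
  refine (measure_mono fun D hD => ?_).trans h
  have hdev : (n : ℝ)⁻¹ * ∑ i, (D i).2 ^ 2 / v - 1 = (responseScale D ^ 2 - v) / v := by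
    rw [responseScale_sq, ← Finset.sum_div, sub_div, div_self hv.ne', mul_div_assoc]
  rw [Set.mem_ofPred_eq, ResponseClose, not_le] at hD
  rw [Set.mem_ofPred_eq, hdev, abs_div, abs_of_pos hv, le_div_iff₀ hv, one_div_mul_eq_div]
  exact hD.le

lemma measure_not_sampleBounded_le (hν : IsSubG ν S K) (hK : 0 < K) (β : Vec d) (σ : ℝ)
    (hv : 0 < responseVar S β σ) {n : ℕ} (hdn : d < n) {η : ℝ} (hη : 0 < η) (hη1 : η < 1) :
    Measure.pi (fun _ : Fin n => sampleLaw ν β σ)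
      {D : Dataset n d | ¬ SampleBounded S K (responseVar S β σ) η D} ≤ ENNReal.ofReal η := by
  have := hν.isProbabilityMeasure
  set ℓ := Real.log (2 * n / η)
  let e (j : Fin d) : Vec d := EuclideanSpace.single j 1
  let A (j : Fin d) : Set (Dataset n d) :=
    {D | ∃ i, 2 * K ^ 2 * ℓ ≤
      |inner ℝ (act (invSqrt S) (e j)) (D i).1 * inner ℝ (act (invSqrt S) (e j)) (D i).1|}
  let B : Set (Dataset n d) :=
    {D | ∃ i, 2 * ((4 * K ^ 2 + 16) * responseVar S β σ) * ℓ ≤ |(D i).2 ^ 2|}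
  have hA (j : Fin d) : Measure.pi (fun _ => sampleLaw ν β σ) (A j) ≤
      ENNReal.ofReal (η ^ 2 / (2 * n)) :=
    ((PsiOneLE.comp_iff (measurePreserving_fst_sampleLaw ν β σ) (by fun_prop)).2
      (hν.psiOneLE_inner_invSqrt_mul hK (by simp [e]) (by simp [e]))).measure_pi_exists_ge_le
        (by positivity) (by fun_prop) (by lia) hη
  have hB : Measure.pi (fun _ => sampleLaw ν β σ) B ≤ ENNReal.ofReal (η ^ 2 / (2 * n)) :=
    (hν.psiOneLE_response_sq hK β σ).measure_pi_exists_ge_le (by positivity) (by fun_prop)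
      (by lia) hη
  have hsub : {D : Dataset n d | ¬ SampleBounded S K (responseVar S β σ) η D} ⊆
      (⋃ j ∈ (Finset.univ : Finset (Fin d)), A j) ∪ B := by
    intro D hD
    by_contra hbdd
    simp only [A, B, Set.mem_union, Set.mem_iUnion, Set.mem_ofPred_eq, not_or, not_exists, not_le,
      Finset.mem_univ, ← sq, abs_sq, true_imp_iff, e] at hbdd
    refine hD fun i => ⟨?_, (hbdd.2 i).le.trans_eq (by ring)⟩
    refine (norm_sq_le_card_mul fun j => ?_).trans_eq (by ring : d * (2 * K ^ 2 * ℓ) = _)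
    have hj := (hbdd.1 j i).le
    rwa [← inner_act_invSqrt, EuclideanSpace.inner_single_left, map_one, one_mul] at hj
  refine (measure_mono hsub).trans ((measure_union_le _ _).trans ((add_le_add
    (measure_biUnion_finset_le_ofReal (k := d) (by simp) (by positivity) fun j _ => hA j)
    hB).trans ?_))
  rw [← ENNReal.ofReal_add (by positivity) (by positivity)]
  refine ENNReal.ofReal_le_ofReal ?_
  have hn : (0 : ℝ) < n := by exact_mod_cast d.zero_le.trans_lt hdn
  have hdn' : (d : ℝ) + 1 ≤ n := by exact_mod_cast hdn
  calc d * (η ^ 2 / (2 * n)) + η ^ 2 / (2 * n) = (d + 1) * η ^ 2 / (2 * n) := by ring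
    _ ≤ n * η ^ 2 / (2 * n) := by gcongr
    _ = η ^ 2 / 2 := by field_simp
    _ ≤ η := by nlinarith

end IsSubG

end Concentration

/-! ### The transformed data -/

lemma clip_eq_self {V : Type*} [NormedAddCommGroup V] [NormedSpace ℝ V] {R : ℝ} {v : V}
    (h : ‖v‖ ≤ R) : clip R v = v := by
  unfold clip
  split_ifs with hR
  · obtain rfl := le_antisymm hR h
    rcases eq_or_ne v 0 with rfl | hv
    · exact smul_zero _
    · rw [div_self (norm_ne_zero_iff.2 hv), one_smul]
  · rfl

section Close

variable {n d : ℕ} {S : Matrix (Fin d) (Fin d) ℝ} {v : ℝ} {D : Dataset n d}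

lemma MomentClose.le_two_mul (h : MomentClose S D) (w : Vec d) :
    inner ℝ w (act S w) ≤ 2 * inner ℝ w (act (secondMoment D) w) := by
  linarith [(abs_le.1 (h w)).1]

lemma MomentClose.two_mul_le (h : MomentClose S D) (w : Vec d) :
    2 * inner ℝ w (act (secondMoment D) w) ≤ 3 * inner ℝ w (act S w) := by
  linarith [(abs_le.1 (h w)).2]

lemma MomentClose.posDef (h : MomentClose S D) (hS : S.PosDef) : (secondMoment D).PosDef := by
  refine posDef_iff_inner_act.2 ⟨transpose_secondMoment D, fun w hw => ?_⟩
  linarith [h.le_two_mul w, (posDef_iff_inner_act.1 hS).2 w hw]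

lemma ResponseClose.le_two_mul (h : ResponseClose v D) : v ≤ 2 * responseScale D ^ 2 := by
  linarith [(abs_le.1 h).1]

lemma ResponseClose.two_mul_le (h : ResponseClose v D) : 2 * responseScale D ^ 2 ≤ 3 * v := by
  linarith [(abs_le.1 h).2]

lemma ResponseClose.responseScale_pos (h : ResponseClose v D) (hv : 0 < v) :
    0 < responseScale D := by
  have hsq : 0 < responseScale D ^ 2 := by linarith [h.le_two_mul]
  exact (Real.sqrt_nonneg _).lt_of_ne' (sq_pos_iff.1 hsq)

lemma MomentClose.norm_invSqrt_act_sq_le (h : MomentClose S D) (hS : S.PosDef) (a : Vec d) :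
    ‖act (invSqrt (secondMoment D)) a‖ ^ 2 ≤ 2 * ‖act (invSqrt S) a‖ ^ 2 := by
  set u := act (invSqrt (secondMoment D)) a with hu
  set w := act (invSqrt (secondMoment D)) u with hw
  have hdual : ‖u‖ ^ 2 = inner ℝ (act (invSqrt S) a) (act (CFC.sqrt S) w) := by
    rw [← inner_act_invSqrt, act_invSqrt_act_sqrt hS, hw, inner_act_invSqrt,
      ← hu, real_inner_self_eq_norm_sq]
  have hwhite : ‖act (CFC.sqrt S) w‖ ^ 2 ≤ 2 * ‖u‖ ^ 2 := by
    rw [← inner_act_self hS, ← real_inner_self_eq_norm_sq u, ← inner_invSqrt_act (h.posDef hS) u u]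
    exact h.le_two_mul w
  rcases (sq_nonneg ‖u‖).eq_or_lt with h0 | h0
  · rw [← h0]
    positivity
  refine le_of_mul_le_mul_right ?_ h0
  calc ‖u‖ ^ 2 * ‖u‖ ^ 2 = inner ℝ (act (invSqrt S) a) (act (CFC.sqrt S) w) ^ 2 := by
        rw [← hdual, ← sq]
    _ ≤ (‖act (invSqrt S) a‖ * ‖act (CFC.sqrt S) w‖) ^ 2 := by
        rw [← hdual]
        gcongr
        exact hdual.trans_le (real_inner_le_norm _ _)
    _ = ‖act (invSqrt S) a‖ ^ 2 * ‖act (CFC.sqrt S) w‖ ^ 2 := mul_pow _ _ _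
    _ ≤ ‖act (invSqrt S) a‖ ^ 2 * (2 * ‖u‖ ^ 2) := by gcongr
    _ = 2 * ‖act (invSqrt S) a‖ ^ 2 * ‖u‖ ^ 2 := by ring

end Close

section Transform

variable {nA nB d : ℕ} (pub : Dataset nB d) (priv : Dataset nA d)

lemma secondMoment_transform :
    secondMoment (transform pub priv) =
      invSqrt (secondMoment pub) * secondMoment priv * invSqrt (secondMoment pub) := by
  have h : designMatrix (transform pub priv) = designMatrix priv * invSqrt (secondMoment pub) := by
    ext i j
    rw [Matrix.mul_apply]
    change ∑ k, invSqrt (secondMoment pub) j k * (priv i).1 k = _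
    refine Finset.sum_congr rfl fun k _ => ?_
    rw [mul_comm, ← Matrix.transpose_apply (invSqrt (secondMoment pub)) j k, transpose_invSqrt]
    rfl
  simp only [secondMoment, h, Matrix.transpose_mul, Matrix.mul_smul, Matrix.smul_mul,
    Matrix.mul_assoc]
  rw [← secondMoment, transpose_invSqrt]

lemma crossMoment_transform :
    crossMoment (transform pub priv) =
      (responseScale pub)⁻¹ • act (invSqrt (secondMoment pub)) (crossMoment priv) := by
  refine ext_inner_left ℝ fun u => ?_
  rw [inner_smul_right, inner_act_invSqrt, inner_crossMoment, inner_crossMoment]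
  simp only [transform, inner_act_invSqrt, Finset.mul_sum]
  exact Finset.sum_congr rfl fun i _ => by ring

lemma responseScale_transform :
    responseScale (transform pub priv) ^ 2 = responseScale priv ^ 2 / responseScale pub ^ 2 := by
  rw [responseScale_sq, responseScale_sq priv]
  simp only [transform, div_pow]
  rw [← Finset.sum_div, mul_div_assoc]

variable {pub}

lemma ols_transform (hB : (secondMoment pub).PosDef) :
    ols (transform pub priv) = transformedOLS pub priv := by
  have hinv : (invSqrt (secondMoment pub))⁻¹ = CFC.sqrt (secondMoment pub) :=
    Matrix.nonsing_inv_nonsing_inv _ (isUnit_det_sqrt hB)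
  rw [ols, transformedOLS, ols, secondMoment_transform, crossMoment_transform, act_smul,
    Matrix.mul_inv_rev, Matrix.mul_inv_rev, hinv, act_mul, act_mul, act_sqrt_act_invSqrt hB]

variable {priv}

lemma pmt_eq_transform_of_close {S : Matrix (Fin d) (Fin d) ℝ} {v K τ η : ℝ} (hS : S.PosDef)
    (hv : 0 < v) (hn : 0 < nA) (hη : 0 < η) (hη1 : η < 1) (hτ : 4 * (4 * K ^ 2 + 16) ≤ τ)
    (hB : MomentClose S pub) (hR : ResponseClose v pub) (hA : SampleBounded S K v η priv) :
    pmt τ η pub priv = transform pub priv := by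
  set ℓ := Real.log (2 * nA / η)
  have hℓ : 0 ≤ ℓ := log_two_mul_div_nonneg hn hη hη1
  have hτ0 : 0 ≤ τ := le_trans (by positivity) hτ
  funext i
  refine Prod.ext (clip_eq_self (Real.le_sqrt_of_sq_le ?_))
    (clip_eq_self (Real.le_sqrt_of_sq_le ?_))
  · calc _ ≤ 2 * ‖act (invSqrt S) (priv i).1‖ ^ 2 := hB.norm_invSqrt_act_sq_le hS _
      _ ≤ 2 * (2 * K ^ 2 * d * ℓ) := by
          gcongr
          exact (hA i).1
      _ = 4 * K ^ 2 * d * ℓ := by ring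
      _ ≤ τ * d * (1 + ℓ) := by
          gcongr
          · linarith [sq_nonneg K]
          · linarith
  · have hscale := hR.responseScale_pos hv
    rw [Real.norm_eq_abs, sq_abs, transform, div_pow, div_le_iff₀ (by positivity), Nat.cast_one,
      mul_one]
    calc (priv i).2 ^ 2 ≤ 2 * (4 * K ^ 2 + 16) * v * ℓ := (hA i).2
      _ = 4 * (4 * K ^ 2 + 16) * ℓ * (v / 2) := by ring
      _ ≤ τ * (1 + ℓ) * responseScale pub ^ 2 := by
          gcongr
          · linarith
          · linarith [hR.le_two_mul]

lemma noTruncationLoss_of_close {S : Matrix (Fin d) (Fin d) ℝ} {v K τ η : ℝ} (hS : S.PosDef)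
    (hv : 0 < v) (hn : 0 < nA) (hη : 0 < η) (hη1 : η < 1) (hτ : 4 * (4 * K ^ 2 + 16) ≤ τ)
    (hB : MomentClose S pub) (hR : ResponseClose v pub) (hA : SampleBounded S K v η priv) :
    NoTruncationLoss τ η pub priv := by
  have heq := pmt_eq_transform_of_close hS hv hn hη hη1 hτ hB hR hA
  exact ⟨hB.posDef hS, hR.responseScale_pos hv, heq, by rw [heq, ols_transform _ (hB.posDef hS)]⟩

end Transform

/-! ### Norms of Gaussian matrices and vectors -/

lemma hasSubgaussianMGF_id_gaussianReal (v : NNReal) :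
    HasSubgaussianMGF id v (gaussianReal 0 v) where
  integrable_exp_mul := integrable_exp_mul_gaussianReal
  mgf_le t := by simp [mgf_id_gaussianReal]

section HasSubgaussianMGF

variable {Ω : Type*} [MeasurableSpace Ω] {μ : Measure Ω} {X : Ω → ℝ} {c : NNReal}

lemma hasSubgaussianMGF_mono (h : HasSubgaussianMGF X c μ) {c' : NNReal} (hc : c ≤ c') :
    HasSubgaussianMGF X c' μ where
  integrable_exp_mul := h.integrable_exp_mul
  mgf_le t := (h.mgf_le t).trans (by gcongr)

lemma measure_abs_ge_le_of_hasSubgaussianMGF [IsFiniteMeasure μ] (h : HasSubgaussianMGF X c μ)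
    {ε : ℝ} (hε : 0 ≤ ε) :
    μ {ω | ε ≤ |X ω|} ≤ ENNReal.ofReal (2 * Real.exp (-ε ^ 2 / (2 * c))) := by
  have hset : {ω | ε ≤ |X ω|} = {ω | ε ≤ X ω} ∪ {ω | ε ≤ (-X) ω} := by
    ext ω
    exact le_abs (a := ε) (b := X ω)
  rw [← ofReal_measureReal, hset]
  refine ENNReal.ofReal_le_ofReal ((measureReal_union_le _ _).trans ?_)
  rw [two_mul]
  exact add_le_add (h.measure_ge_le hε) (h.neg.measure_ge_le hε)

end HasSubgaussianMGF

lemma hasSubgaussianMGF_sum_pi {ι : Type*} [Fintype ι] {Ω : ι → Type*}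
    [∀ i, MeasurableSpace (Ω i)] {μ : ∀ i, Measure (Ω i)} [∀ i, IsProbabilityMeasure (μ i)]
    {X : ∀ i, Ω i → ℝ} {c : ι → NNReal} (h : ∀ i, HasSubgaussianMGF (X i) (c i) (μ i)) :
    HasSubgaussianMGF (fun ω => ∑ i, X i (ω i)) (∑ i, c i) (Measure.pi μ) :=
  HasSubgaussianMGF.sum_of_iIndepFun (iIndepFun_pi fun i => (h i).aemeasurable)
    fun i _ => HasSubgaussianMGF.of_map (measurable_pi_apply i).aemeasurable
      ((measurePreserving_eval μ i).map_eq.symm ▸ h i)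

lemma hasSubgaussianMGF_sum_mul_gaussianReal {ι : Type*} [Fintype ι] (v : NNReal) (a : ι → ℝ) :
    HasSubgaussianMGF (fun w => ∑ i, a i * w i) (∑ i, ‖a i‖₊ ^ 2 * v)
      (Measure.pi fun _ : ι => gaussianReal 0 v) :=
  hasSubgaussianMGF_sum_pi fun i => hasSubgaussianMGF_mono
    ((hasSubgaussianMGF_id_gaussianReal v).const_mul (a i))
    (mul_le_mul_of_nonneg_right
      (NNReal.coe_le_coe.1 (by rw [NNReal.coe_pow, coe_nnnorm, Real.norm_eq_abs, sq_abs]; rfl))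
      zero_le)

/-- The covering number `25 ^ d` of a pair of half-nets is absorbed by `exp (-4d)`. -/
lemma pow_mul_exp_neg_le {d : ℕ} {η a : ℝ} (hη : 0 < η) (hη1 : η < 1)
    (ha : 4 * (√d + √(Real.log (1 / η))) ^ 2 ≤ a) : 25 ^ d * Real.exp (-a) ≤ η := by
  have hlog : 0 ≤ Real.log (1 / η) := Real.log_nonneg (by rw [one_le_div hη]; exact hη1.le)
  have hsq : (d : ℝ) + Real.log (1 / η) ≤ (√d + √(Real.log (1 / η))) ^ 2 := by
    rw [add_sq, Real.sq_sqrt (by positivity), Real.sq_sqrt hlog]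
    linarith [show 0 ≤ 2 * √(d : ℝ) * √(Real.log (1 / η)) by positivity]
  have hexp : (25 : ℝ) ≤ Real.exp 4 :=
    calc (25 : ℝ) ≤ 2.7 ^ 4 := by norm_num
      _ ≤ Real.exp 1 ^ 4 := by gcongr; linarith [Real.exp_one_gt_d9]
      _ = Real.exp 4 := by rw [← Real.exp_nat_mul]; norm_num
  calc 25 ^ d * Real.exp (-a) ≤ Real.exp 4 ^ d * Real.exp (-a) := by gcongr
    _ = Real.exp (d * 4 - a) := by rw [← Real.exp_nat_mul, ← Real.exp_add, sub_eq_add_neg]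
    _ ≤ Real.exp (-Real.log (1 / η)) := Real.exp_le_exp.2 (by linarith)
    _ = η := by rw [one_div, Real.log_inv, neg_neg, Real.exp_log hη]

section GaussianNorm

variable {d : ℕ}

/-- Coefficients of the bilinear form of `symMatrix W` in the entries of `W`, of which only those
on and above the diagonal are used. -/
def symCoeff (u v : Vec d) (i j : Fin d) : ℝ :=
  (if i ≤ j then u i * v j else 0) + if i < j then u j * v i else 0

lemma inner_act_symMatrix (W : Fin d → Fin d → ℝ) (u v : Vec d) :
    inner ℝ u (act (symMatrix W) v) = ∑ i, ∑ j, symCoeff u v i j * W i j := by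
  have hsplit (i j) : symMatrix W i j * (u i * v j) =
      (if i ≤ j then u i * v j else 0) * W i j + (if j < i then u i * v j else 0) * W j i := by
    simp only [symMatrix, Matrix.of_apply]
    rcases le_or_gt i j with h | h
    · rw [min_eq_left h, max_eq_right h, if_pos h, if_neg h.not_gt]; ring
    · rw [min_eq_right h.le, max_eq_left h.le, if_neg h.not_ge, if_pos h]; ring
  rw [inner_act]
  simp_rw [hsplit, symCoeff, add_mul, Finset.sum_add_distrib]
  congr 1
  exact Finset.sum_comm

lemma sum_symCoeff_sq_le (u v : Vec d) :
    ∑ i, ∑ j, symCoeff u v i j ^ 2 ≤ 4 * (‖u‖ ^ 2 * ‖v‖ ^ 2) := by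
  have hle (i j) : symCoeff u v i j ^ 2 ≤ 2 * (u i ^ 2 * v j ^ 2) + 2 * (v i ^ 2 * u j ^ 2) := by
    unfold symCoeff
    split_ifs <;> nlinarith [sq_nonneg (u i * v j - u j * v i), sq_nonneg (u i * v j),
      sq_nonneg (u j * v i)]
  calc ∑ i, ∑ j, symCoeff u v i j ^ 2
      ≤ ∑ i, ∑ j, (2 * (u i ^ 2 * v j ^ 2) + 2 * (v i ^ 2 * u j ^ 2)) := by gcongr; apply hle
    _ = 4 * (‖u‖ ^ 2 * ‖v‖ ^ 2) := by
        simp only [Finset.sum_add_distrib, ← Finset.mul_sum, ← Finset.sum_mul,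
          ← EuclideanSpace.real_norm_sq_eq]
        ring

lemma hasSubgaussianMGF_inner_act_symMatrix (w : NNReal) {u v : Vec d} (hu : ‖u‖ ≤ 1)
    (hv : ‖v‖ ≤ 1) :
    HasSubgaussianMGF (fun W => inner ℝ u (act (symMatrix W) v)) (4 * w)
      (Measure.pi fun _ : Fin d => Measure.pi fun _ : Fin d => gaussianReal 0 w) := by
  simp only [inner_act_symMatrix]
  refine hasSubgaussianMGF_mono (hasSubgaussianMGF_sum_pi fun i =>
    hasSubgaussianMGF_sum_mul_gaussianReal w (symCoeff u v i)) ?_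
  simp only [← Finset.sum_mul]
  gcongr
  rw [← NNReal.coe_le_coe]
  simp only [NNReal.coe_sum, NNReal.coe_pow, coe_nnnorm, Real.norm_eq_abs, sq_abs,
    NNReal.coe_ofNat]
  refine (sum_symCoeff_sq_le u v).trans ?_
  nlinarith [pow_le_one₀ (norm_nonneg u) hu (n := 2), pow_le_one₀ (norm_nonneg v) hv (n := 2),
    sq_nonneg ‖u‖]

lemma hasSubgaussianMGF_inner_toLp (w : NNReal) {u : Vec d} (hu : ‖u‖ ≤ 1) :
    HasSubgaussianMGF (fun g : Fin d → ℝ => inner ℝ (WithLp.toLp 2 g) u) w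
      (Measure.pi fun _ : Fin d => gaussianReal 0 w) := by
  refine hasSubgaussianMGF_mono (c := ∑ i, ‖u i‖₊ ^ 2 * w)
    ((hasSubgaussianMGF_sum_mul_gaussianReal w u).congr (.of_eq ?_)) ?_
  · ext g
    simp [PiLp.inner_apply]
  · rw [← Finset.sum_mul]
    refine mul_le_of_le_one_left' ?_
    rw [← NNReal.coe_le_coe]
    simp only [NNReal.coe_sum, NNReal.coe_pow, coe_nnnorm, NNReal.coe_one,
      ← EuclideanSpace.norm_sq_eq]
    exact pow_le_one₀ (norm_nonneg u) hu

lemma opNorm_le_of_inner_le {M : Matrix (Fin d) (Fin d) ℝ} {c : ℝ} (hc : 0 ≤ c)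
    (h : ∀ u v : Vec d, inner ℝ u (act M v) ≤ c * ‖u‖ * ‖v‖) : opNorm M ≤ c := by
  refine ContinuousLinearMap.opNorm_le_bound _ hc fun v => ?_
  change ‖act M v‖ ≤ _
  have hself := h (act M v) v
  rw [real_inner_self_eq_norm_sq] at hself
  rcases (norm_nonneg (act M v)).eq_or_lt with h0 | h0
  · rw [← h0]; positivity
  · exact le_of_mul_le_mul_right (by linarith : ‖act M v‖ * ‖act M v‖ ≤ c * ‖v‖ * ‖act M v‖) h0

lemma IsHalfNet.opNorm_le {N : Finset (Vec d)} (hN : IsHalfNet N) {M : Matrix (Fin d) (Fin d) ℝ}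
    {δ : ℝ} (hδ : 0 ≤ δ) (h : ∀ u ∈ N, ∀ v ∈ N, |inner ℝ u (act M v)| ≤ δ) :
    opNorm M ≤ 4 * δ := by
  let B : Vec d →ₗ[ℝ] Vec d →ₗ[ℝ] ℝ := LinearMap.mk₂ ℝ (fun u v => inner ℝ u (act M v))
    (fun a b c => by simp only [inner_add_left])
    (fun a b c => by simp only [real_inner_smul_left, smul_eq_mul])
    (fun a b c => by simp only [act_add, inner_add_right])
    (fun a b c => by simp only [act_smul, real_inner_smul_right, smul_eq_mul])
  exact opNorm_le_of_inner_le (by positivity) fun u v =>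
    (le_abs_self _).trans (hN.abs_bilin_le B h u v)

lemma measure_opNorm_symMatrix_gt_le {s η : ℝ} (hs : 0 < s) (hη : 0 < η) (hη1 : η < 1) :
    Measure.pi (fun _ : Fin d => Measure.pi fun _ : Fin d => gaussianReal 0 (s ^ 2).toNNReal)
      {W | ¬ opNorm (symMatrix W) ≤ 24 * s * (√d + √(Real.log (1 / η)))} ≤
        ENNReal.ofReal (2 * η) := by
  obtain ⟨N, hN, hcard⟩ := exists_isHalfNet (Vec d)
  rw [finrank_euclideanSpace_fin] at hcard
  have hcard2 : ((N ×ˢ N).card : ℝ) ≤ 25 ^ d := by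
    rw [Finset.card_product, show (25 : ℝ) ^ d = 5 ^ d * 5 ^ d by rw [← mul_pow]; norm_num]
    exact_mod_cast Nat.mul_le_mul hcard hcard
  set x := √d + √(Real.log (1 / η))
  have hsub : {W : Fin d → Fin d → ℝ | ¬ opNorm (symMatrix W) ≤ 24 * s * x} ⊆
      ⋃ p ∈ N ×ˢ N, {W | 6 * s * x ≤ |inner ℝ p.1 (act (symMatrix W) p.2)|} := by
    intro W hW
    by_contra hsmall
    simp only [Set.mem_iUnion, Set.mem_ofPred_eq, not_exists, not_le] at hsmall
    exact hW ((hN.opNorm_le (δ := 6 * s * x) (by positivity) fun u hu v hv =>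
      (hsmall (u, v) (Finset.mk_mem_product hu hv)).le).trans_eq (by ring))
  have htail (p) (hp : p ∈ N ×ˢ N) := measure_abs_ge_le_of_hasSubgaussianMGF
    (hasSubgaussianMGF_inner_act_symMatrix (s ^ 2).toNNReal
      (hN.norm_le_one _ (Finset.mem_product.1 hp).1)
      (hN.norm_le_one _ (Finset.mem_product.1 hp).2)) (ε := 6 * s * x) (by positivity)
  refine (measure_mono hsub).trans ((measure_biUnion_finset_le_ofReal hcard2 (by positivity)
    htail).trans (ENNReal.ofReal_le_ofReal ?_))
  have hexp := pow_mul_exp_neg_le (d := d) hη hη1 (a := 9 / 2 * x ^ 2) (by nlinarith)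
  rw [NNReal.coe_mul, NNReal.coe_ofNat, Real.coe_toNNReal _ (sq_nonneg s),
    show -(6 * s * x) ^ 2 / (2 * (4 * s ^ 2)) = -(9 / 2 * x ^ 2) by field_simp; ring]
  linarith

lemma measure_norm_gt_le {s η : ℝ} (hs : 0 < s) (hη : 0 < η) (hη1 : η < 1) :
    ((Measure.pi fun _ : Fin d => gaussianReal 0 (s ^ 2).toNNReal).map (WithLp.toLp 2))
      {g : Vec d | ¬ ‖g‖ ≤ 6 * s * (√d + √(Real.log (1 / η)))} ≤ ENNReal.ofReal (2 * η) := by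
  obtain ⟨N, hN, hcard⟩ := exists_isHalfNet (Vec d)
  rw [finrank_euclideanSpace_fin] at hcard
  have hcard' : (N.card : ℝ) ≤ 25 ^ d := by
    exact_mod_cast hcard.trans (Nat.pow_le_pow_left (by norm_num) d)
  set x := √d + √(Real.log (1 / η))
  have hmeas : MeasurableSet {g : Vec d | ¬ ‖g‖ ≤ 6 * s * x} :=
    (measurableSet_le measurable_norm measurable_const).compl
  have hsub : WithLp.toLp 2 ⁻¹' {g : Vec d | ¬ ‖g‖ ≤ 6 * s * x} ⊆
      ⋃ u ∈ N, {w : Fin d → ℝ | 3 * s * x ≤ |inner ℝ (WithLp.toLp 2 w) u|} := by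
    intro w hw
    by_contra hsmall
    simp only [Set.mem_iUnion, Set.mem_ofPred_eq, not_exists, not_le] at hsmall
    have hnorm := hN.norm_le_two_mul (innerSL ℝ (WithLp.toLp 2 w)) fun u hu => (hsmall u hu).le
    rw [innerSL_apply_norm] at hnorm
    exact hw (hnorm.trans_eq (by ring))
  have htail (u) (hu : u ∈ N) := measure_abs_ge_le_of_hasSubgaussianMGF
    (hasSubgaussianMGF_inner_toLp (s ^ 2).toNNReal (hN.norm_le_one u hu)) (ε := 3 * s * x)
    (by positivity)
  rw [Measure.map_apply (measurable_toLp_vec d) hmeas]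
  refine (measure_mono hsub).trans ((measure_biUnion_finset_le_ofReal hcard' (by positivity)
    htail).trans (ENNReal.ofReal_le_ofReal ?_))
  have hexp := pow_mul_exp_neg_le (d := d) hη hη1 (a := 9 / 2 * x ^ 2) (by nlinarith)
  rw [Real.coe_toNNReal _ (sq_nonneg s),
    show -(3 * s * x) ^ 2 / (2 * s ^ 2) = -(9 / 2 * x ^ 2) by field_simp; ring]
  linarith

end GaussianNorm

/-! ### Perturbation of the least squares estimator -/

section Perturbation

variable {d : ℕ}

lemma isUnit_det_of_le_inner {M : Matrix (Fin d) (Fin d) ℝ} {c : ℝ} (hc : 0 < c)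
    (h : ∀ u : Vec d, c * ‖u‖ ^ 2 ≤ inner ℝ u (act M u)) : IsUnit M.det := by
  refine isUnit_iff_ne_zero.2 fun hdet => ?_
  obtain ⟨x, hx, hMx⟩ := Matrix.exists_mulVec_eq_zero_iff.2 hdet
  have hact : act M (WithLp.toLp 2 x) = 0 := by
    rw [act, Matrix.toEuclideanCLM_toLp, hMx]; rfl
  have hle := h (WithLp.toLp 2 x)
  rw [hact, inner_zero_right] at hle
  have hx0 : 0 < ‖(WithLp.toLp 2 x : Vec d)‖ := norm_pos_iff.2 (by simpa using hx)
  exact hle.not_gt (by positivity)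

lemma act_act_inv {M : Matrix (Fin d) (Fin d) ℝ} (h : IsUnit M.det) (v : Vec d) :
    act M (act M⁻¹ v) = v := by
  rw [← act_mul, Matrix.mul_nonsing_inv _ h, act_one]

lemma mul_norm_le_norm_act {M : Matrix (Fin d) (Fin d) ℝ} {c : ℝ}
    (h : ∀ u : Vec d, c * ‖u‖ ^ 2 ≤ inner ℝ u (act M u)) (u : Vec d) :
    c * ‖u‖ ≤ ‖act M u‖ := by
  rcases (norm_nonneg u).eq_or_lt with h0 | h0
  · rw [← h0]; simp
  · have hle := (h u).trans (real_inner_le_norm _ _)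
    exact le_of_mul_le_mul_left (by linarith : ‖u‖ * (c * ‖u‖) ≤ ‖u‖ * ‖act M u‖) h0

lemma half_mul_norm_sq_le_inner_add {M G : Matrix (Fin d) (Fin d) ℝ} {c : ℝ}
    (hM : ∀ u : Vec d, c * ‖u‖ ^ 2 ≤ inner ℝ u (act M u)) (hG : opNorm G ≤ c / 2) (u : Vec d) :
    c / 2 * ‖u‖ ^ 2 ≤ inner ℝ u (act (M + G) u) := by
  have hGu : |inner ℝ u (act G u)| ≤ c / 2 * ‖u‖ ^ 2 :=
    calc |inner ℝ u (act G u)| ≤ ‖u‖ * ‖act G u‖ := abs_real_inner_le_norm _ _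
      _ ≤ ‖u‖ * (c / 2 * ‖u‖) := by gcongr; exact (norm_act_le G u).trans (by gcongr)
      _ = c / 2 * ‖u‖ ^ 2 := by ring
  rw [add_act, inner_add_right]
  linarith [hM u, (abs_le.1 hGu).1]

/-- The error `e = (M + G)⁻¹ (M b + g) - b` satisfies `(M + G) e = g - G b`. -/
lemma half_mul_norm_act_inv_sub_le {M G : Matrix (Fin d) (Fin d) ℝ} {c : ℝ} (hc : 0 < c)
    (hM : ∀ u : Vec d, c * ‖u‖ ^ 2 ≤ inner ℝ u (act M u)) (hG : opNorm G ≤ c / 2) (b g : Vec d) :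
    c / 2 * ‖act (M + G)⁻¹ (act M b + g) - b‖ ≤ ‖g‖ + opNorm G * ‖b‖ := by
  have hMG := half_mul_norm_sq_le_inner_add hM hG
  have hdet : IsUnit (M + G).det := isUnit_det_of_le_inner (half_pos hc) hMG
  calc c / 2 * ‖act (M + G)⁻¹ (act M b + g) - b‖
      ≤ ‖act (M + G) (act (M + G)⁻¹ (act M b + g) - b)‖ := mul_norm_le_norm_act hMG _
    _ = ‖g - act G b‖ := by rw [act_sub, act_act_inv hdet, add_act]; congr 1; abel
    _ ≤ ‖g‖ + ‖act G b‖ := norm_sub_le _ _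
    _ ≤ ‖g‖ + opNorm G * ‖b‖ := by gcongr; exact norm_act_le G b

/-- As `⟨b, Σ̂ b⟩ = n⁻¹ ∑ i, ⟨b, xᵢ⟩ yᵢ` at `b = ols D`, this is the Cauchy–Schwarz inequality. -/
lemma mul_norm_ols_sq_le {n : ℕ} {D : Dataset n d} {c : ℝ} (hc : 0 < c)
    (h : ∀ u : Vec d, c * ‖u‖ ^ 2 ≤ inner ℝ u (act (secondMoment D) u)) :
    c * ‖ols D‖ ^ 2 ≤ responseScale D ^ 2 := by
  set b := ols D
  set Q := inner ℝ b (act (secondMoment D) b) with hQ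
  have hact : act (secondMoment D) b = crossMoment D :=
    act_act_inv (isUnit_det_of_le_inner hc h) _
  have hcross : Q = (n : ℝ)⁻¹ * ∑ i, inner ℝ b (D i).1 * (D i).2 := by
    rw [hQ, hact, inner_crossMoment]
  have hcs : Q * Q ≤ Q * responseScale D ^ 2 :=
    calc Q * Q = (n : ℝ)⁻¹ ^ 2 * (∑ i, inner ℝ b (D i).1 * (D i).2) ^ 2 := by rw [hcross]; ring
      _ ≤ (n : ℝ)⁻¹ ^ 2 * ((∑ i, inner ℝ b (D i).1 ^ 2) * ∑ i, (D i).2 ^ 2) := by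
          gcongr
          exact Finset.sum_mul_sq_le_sq_mul_sq _ _ _
      _ = Q * responseScale D ^ 2 := by
          rw [hQ, inner_secondMoment, responseScale_sq]
          simp only [sq]
          ring
  refine (h b).trans ?_
  rcases (show 0 ≤ Q from (h b).trans' (by positivity)).eq_or_lt with h0 | h0
  · exact h0.symm.trans_le (sq_nonneg _)
  · exact le_of_mul_le_mul_left hcs h0

variable {nA nB : ℕ} {S : Matrix (Fin d) (Fin d) ℝ} {v τ η : ℝ} {pub : Dataset nB d}
  {priv : Dataset nA d}

lemma norm_sq_le_inner_secondMoment_transform (hS : S.PosDef) (hA : MomentClose S priv)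
    (hB : MomentClose S pub) (u : Vec d) :
    1 / 3 * ‖u‖ ^ 2 ≤ inner ℝ u (act (secondMoment (transform pub priv)) u) := by
  rw [secondMoment_transform, act_mul, act_mul, inner_act_invSqrt]
  have hwhite := inner_invSqrt_act (hB.posDef hS) u u
  rw [real_inner_self_eq_norm_sq] at hwhite
  linarith [hA.le_two_mul (act (invSqrt (secondMoment pub)) u),
    hB.two_mul_le (act (invSqrt (secondMoment pub)) u)]

lemma norm_ols_transform_le (hS : S.PosDef) (hA : MomentClose S priv) (hB : MomentClose S pub)
    (hRA : ResponseClose v priv) (hRB : ResponseClose v pub) (hpub : 0 < responseScale pub) :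
    ‖ols (transform pub priv)‖ ≤ 3 := by
  have hols := mul_norm_ols_sq_le (by norm_num)
    (norm_sq_le_inner_secondMoment_transform hS hA hB)
  have hratio : responseScale priv ^ 2 / responseScale pub ^ 2 ≤ 3 := by
    rw [div_le_iff₀ (by positivity)]
    linarith [hRA.two_mul_le, hRB.le_two_mul]
  rw [responseScale_transform] at hols
  exact le_of_sq_le_sq (by linarith) (by norm_num)

lemma isUnit_det_noisyMoment_and_norm_dpTransformed_sub_le (hS : S.PosDef)
    (hA : MomentClose S priv) (hB : MomentClose S pub) (hRA : ResponseClose v priv)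
    (hRB : ResponseClose v pub) (hT : NoTruncationLoss τ η pub priv)
    {w : (Fin d → Fin d → ℝ) × Vec d} (hG : opNorm (symMatrix w.1) ≤ 1 / 6) :
    IsUnit (noisyMoment τ η pub priv w).det ∧
      ‖dpTransformed τ η pub priv w - transformedOLS pub priv‖ ≤
        6 * (‖w.2‖ + 3 * opNorm (symMatrix w.1)) := by
  obtain ⟨-, hpub, hpmt, hols⟩ := hT
  rw [hpmt] at hols
  have hM := norm_sq_le_inner_secondMoment_transform hS hA hB
  have hG' : opNorm (symMatrix w.1) ≤ 1 / 3 / 2 := by linarith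
  have hb := norm_ols_transform_le hS hA hB hRA hRB hpub
  have hact : act (secondMoment (transform pub priv)) (ols (transform pub priv)) =
      crossMoment (transform pub priv) := act_act_inv (isUnit_det_of_le_inner (by norm_num) hM) _
  rw [dpTransformed, noisyMoment, hpmt, ← hols, ← hact]
  refine ⟨isUnit_det_of_le_inner (by norm_num) (half_mul_norm_sq_le_inner_add hM hG'), ?_⟩
  have herr := half_mul_norm_act_inv_sub_le (by norm_num) hM hG' (ols (transform pub priv)) w.2
  have hGb := mul_le_mul_of_nonneg_left hb (opNorm_nonneg (symMatrix w.1))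
  linarith

lemma norm_dpRecovered_sub_le (hB : (secondMoment pub).PosDef) (hpub : 0 < responseScale pub)
    (w : (Fin d → Fin d → ℝ) × Vec d) :
    ‖dpRecovered τ η pub priv w - ols priv‖ ≤ responseScale pub *
      (opNorm (invSqrt (secondMoment pub)) *
        ‖dpTransformed τ η pub priv w - transformedOLS pub priv‖) := by
  have hsub : dpRecovered τ η pub priv w - ols priv = responseScale pub •
      act (invSqrt (secondMoment pub))
        (dpTransformed τ η pub priv w - transformedOLS pub priv) := by
    rw [act_sub, smul_sub, dpRecovered, transformedOLS, act_smul, act_invSqrt_act_sqrt hB,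
      smul_inv_smul₀ hpub.ne']
  rw [hsub, norm_smul, Real.norm_of_nonneg hpub.le]
  gcongr
  exact norm_act_le _ _

/-! ### The scale of the error bound -/

lemma opNorm_le_of_inner_self_le (hS : S.PosDef) {k : ℝ} (hk : 0 ≤ k)
    (h : ∀ u : Vec d, inner ℝ u (act S u) ≤ k * ‖u‖ ^ 2) : opNorm S ≤ k := by
  have hsqrt (u : Vec d) : ‖act (CFC.sqrt S) u‖ ≤ √k * ‖u‖ := by
    refine le_of_sq_le_sq ?_ (by positivity)
    rw [mul_pow, Real.sq_sqrt hk, ← inner_act_self hS]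
    exact h u
  refine opNorm_le_of_inner_le hk fun u v => ?_
  calc inner ℝ u (act S v) = inner ℝ (act (CFC.sqrt S) u) (act (CFC.sqrt S) v) :=
        inner_act_eq_inner_sqrt hS u v
    _ ≤ ‖act (CFC.sqrt S) u‖ * ‖act (CFC.sqrt S) v‖ := real_inner_le_norm _ _
    _ ≤ √k * ‖u‖ * (√k * ‖v‖) := by gcongr <;> apply hsqrt
    _ = k * ‖u‖ * ‖v‖ := by rw [mul_mul_mul_comm, Real.mul_self_sqrt hk, mul_assoc]

lemma norm_sq_le_opNorm_invSqrt_sq_mul (hS : S.PosDef) (u : Vec d) :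
    ‖u‖ ^ 2 ≤ opNorm (invSqrt S) ^ 2 * inner ℝ u (act S u) := by
  rw [inner_act_self hS, ← mul_pow]
  gcongr
  simpa only [act_invSqrt_act_sqrt hS] using norm_act_le (invSqrt S) (act (CFC.sqrt S) u)

lemma MomentClose.opNorm_le_two_mul {n : ℕ} {D : Dataset n d} (h : MomentClose S D)
    (hS : S.PosDef) : opNorm S ≤ 2 * opNorm (secondMoment D) :=
  opNorm_le_of_inner_self_le hS (mul_nonneg zero_le_two (opNorm_nonneg _)) fun u => by
    linarith [h.le_two_mul u, inner_act_le (secondMoment D) u]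

lemma MomentClose.two_le_opNorm_invSqrt_sq_mul {n : ℕ} {D : Dataset n d} (h : MomentClose S D)
    (hS : S.PosDef) {u : Vec d} (hu : u ≠ 0) :
    2 ≤ 3 * (opNorm (invSqrt (secondMoment D)) ^ 2 * opNorm S) := by
  have hu0 : 0 < ‖u‖ := norm_pos_iff.2 hu
  refine le_of_mul_le_mul_right (?_ : 2 * ‖u‖ ^ 2 ≤ _ * ‖u‖ ^ 2) (pow_pos hu0 2)
  set p := opNorm (invSqrt (secondMoment D))
  calc 2 * ‖u‖ ^ 2 ≤ p ^ 2 * (2 * inner ℝ u (act (secondMoment D) u)) := by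
        linarith [norm_sq_le_opNorm_invSqrt_sq_mul (h.posDef hS) u]
    _ ≤ p ^ 2 * (3 * (opNorm S * ‖u‖ ^ 2)) := by
        refine mul_le_mul_of_nonneg_left ?_ (sq_nonneg p)
        linarith [h.two_mul_le u, inner_act_le S u]
    _ = 3 * (p ^ 2 * opNorm S) * ‖u‖ ^ 2 := by ring

lemma responseVar_le {β : Vec d} {σ s : ℝ} (hs : 0 ≤ s) (hσ0 : 0 ≤ σ)
    (hσ : σ ≤ s * (√(opNorm S) * ‖β‖)) :
    responseVar S β σ ≤ (1 + s) ^ 2 * (opNorm S * ‖β‖ ^ 2) := by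
  have hsignal : 0 ≤ opNorm S * ‖β‖ ^ 2 := mul_nonneg (opNorm_nonneg S) (sq_nonneg _)
  have hnoise : σ ^ 2 ≤ s ^ 2 * (opNorm S * ‖β‖ ^ 2) :=
    calc σ ^ 2 ≤ (s * (√(opNorm S) * ‖β‖)) ^ 2 := by gcongr
      _ = s ^ 2 * (opNorm S * ‖β‖ ^ 2) := by
          rw [mul_pow, mul_pow, Real.sq_sqrt (opNorm_nonneg S)]
  rw [responseVar]
  nlinarith [inner_act_le S β, mul_nonneg hs hsignal]

lemma one_le_mul_signalScale {β : Vec d} {σ s : ℝ} (hs : 0 ≤ s) (hS : S.PosDef) (hβ : β ≠ 0)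
    (hσ0 : 0 ≤ σ) (hσ : σ ≤ s * (√(opNorm S) * ‖β‖)) (hA : MomentClose S priv)
    (hB : MomentClose S pub) (hRB : ResponseClose (responseVar S β σ) pub)
    (hpub : 0 < responseScale pub) :
    1 ≤ 3 * (1 + s) * (‖β‖ * opNorm (secondMoment priv) * opNorm (invSqrt (secondMoment pub)) /
      responseScale pub) := by
  have ht := hA.opNorm_le_two_mul hS
  have hp := hB.two_le_opNorm_invSqrt_sq_mul hS hβ
  have hr : responseScale pub ^ 2 ≤ 3 / 2 * ((1 + s) ^ 2 * (opNorm S * ‖β‖ ^ 2)) := by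
    linarith [hRB.two_mul_le, responseVar_le hs hσ0 hσ]
  have hp0 := opNorm_nonneg (invSqrt (secondMoment pub))
  have ht0 := opNorm_nonneg S
  have ha0 := opNorm_nonneg (secondMoment priv)
  set a := opNorm (secondMoment priv)
  set p := opNorm (invSqrt (secondMoment pub))
  set t := opNorm S
  rw [← mul_div_assoc, one_le_div hpub]
  refine le_of_sq_le_sq ?_ (by positivity)
  calc responseScale pub ^ 2 ≤ 3 / 2 * ((1 + s) ^ 2 * (t * ‖β‖ ^ 2)) := hr
    _ = 3 / 4 * ((1 + s) ^ 2 * (t * ‖β‖ ^ 2)) * 2 := by ring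
    _ ≤ 3 / 4 * ((1 + s) ^ 2 * (t * ‖β‖ ^ 2)) * (3 * (p ^ 2 * t)) := by gcongr
    _ = 9 / 4 * ((1 + s) ^ 2 * ‖β‖ ^ 2 * p ^ 2) * t ^ 2 := by ring
    _ ≤ 9 / 4 * ((1 + s) ^ 2 * ‖β‖ ^ 2 * p ^ 2) * (2 * a) ^ 2 := by gcongr
    _ = (3 * (1 + s) * (‖β‖ * a * p)) ^ 2 := by ring

end Perturbation

/-! ### Size of the noise -/

/-- The rate `d ^ (3/2) (1 + log (2n/η)) log (1/η) / (√ρ n)` at which the Gaussian noise perturbs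
the estimator. -/
def errorRate (ρ η : ℝ) (d n : ℕ) : ℝ :=
  (d : ℝ) ^ (3 / 2 : ℝ) * (1 + Real.log (2 * n / η)) * Real.log (1 / η) / (√ρ * n)

/-- Bounds on the noise matrix and on the noise vector that hold with probability
`1 - O(η)`. -/
def NoiseBounded (τ ρ η : ℝ) (d n : ℕ) (w : (Fin d → Fin d → ℝ) × Vec d) : Prop :=
  opNorm (symMatrix w.1) ≤ 24 * noiseScale₁ τ ρ η d n * (√d + √(Real.log (1 / η))) ∧
    ‖w.2‖ ≤ 6 * noiseScale₂ τ ρ η d n * (√d + √(Real.log (1 / η)))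

lemma add_sqrt_mul_sqrt_le {x y : ℝ} (hx : 1 ≤ x) (hy : 1 ≤ y) :
    (√x + √y) * √y ≤ 2 * (√x * y) := by
  have hsx : 1 ≤ √x := Real.one_le_sqrt.2 hx
  calc (√x + √y) * √y ≤ (√x * √y + √x * √y) * √y := by
        gcongr
        · exact le_mul_of_one_le_right (by positivity) (Real.one_le_sqrt.2 hy)
        · exact le_mul_of_one_le_left (by positivity) hsx
    _ = 2 * (√x * (√y * √y)) := by ring
    _ = 2 * (√x * y) := by rw [Real.mul_self_sqrt (by linarith)]

lemma measure_not_and_le {Ω : Type*} [MeasurableSpace Ω] {μ : Measure Ω} {p q : Ω → Prop}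
    {a b : ℝ} (ha : 0 ≤ a) (hb : 0 ≤ b) (hp : μ {ω | ¬ p ω} ≤ ENNReal.ofReal a)
    (hq : μ {ω | ¬ q ω} ≤ ENNReal.ofReal b) :
    μ {ω | ¬ (p ω ∧ q ω)} ≤ ENNReal.ofReal (a + b) := by
  simp only [not_and_or, Set.ofPred_or]
  rw [ENNReal.ofReal_add ha hb]
  exact (measure_union_le _ _).trans (add_le_add hp hq)

section Noise

variable {d n : ℕ} {τ ρ η : ℝ}

lemma errorRate_nonneg (hn : 0 < n) (hη : 0 < η) (hη1 : η < 1) : 0 ≤ errorRate ρ η d n := by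
  have hl := (one_add_log_pos hn hη hη1).le
  have hlog : 0 ≤ Real.log (1 / η) := Real.log_nonneg (one_le_one_div hη hη1.le)
  unfold errorRate
  positivity

lemma noiseScale₁_mul_sqrt_mul_log (hd : 0 < d) :
    noiseScale₁ τ ρ η d n * (√d * Real.log (1 / η)) = √2 * (τ * errorRate ρ η d n) := by
  have hpow : (d : ℝ) ^ (3 / 2 : ℝ) = d * √d := by
    rw [show (3 / 2 : ℝ) = 1 + 1 / 2 by norm_num, Real.rpow_add (by positivity), Real.rpow_one,
      Real.sqrt_eq_rpow]
  have htwo : 2 / √(2 * ρ) = √2 / √ρ := by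
    rw [Real.sqrt_mul zero_le_two, div_mul_eq_div_div, Real.div_sqrt]
  calc noiseScale₁ τ ρ η d n * (√d * Real.log (1 / η))
      = 2 / √(2 * ρ) *
          (τ * d * √d * (1 + Real.log (2 * n / η)) * Real.log (1 / η) / n) := by
        rw [noiseScale₁]; ring
    _ = √2 * (τ * errorRate ρ η d n) := by rw [htwo, errorRate, hpow]; ring

lemma noiseScale₂_le_noiseScale₁ (hτ : 0 < τ) (hn : 0 < n) (hη : 0 < η) (hη1 : η < 1) :
    noiseScale₂ τ ρ η d n ≤ noiseScale₁ τ ρ η d n := by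
  have hl := one_add_log_pos hn hη hη1
  have hsqrt : √(d : ℝ) ≤ d := by
    rw [Real.sqrt_le_self_iff]
    rcases d.eq_zero_or_pos with h | h
    · exact Or.inl (by exact_mod_cast h)
    · exact Or.inr (by exact_mod_cast h)
  unfold noiseScale₁ noiseScale₂
  gcongr

lemma noiseScale₁_mul_add_sqrt_mul_sqrt_le (hd : 0 < d) (hτ : 0 < τ) (hn : 0 < n) (hη : 0 < η)
    (hη1 : η < 1) (hlog : 1 ≤ Real.log (1 / η)) :
    noiseScale₁ τ ρ η d n * ((√d + √(Real.log (1 / η))) * √(Real.log (1 / η))) ≤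
      3 * (τ * errorRate ρ η d n) := by
  have hl := one_add_log_pos hn hη hη1
  have hX : 0 ≤ τ * errorRate ρ η d n := mul_nonneg hτ.le (errorRate_nonneg hn hη hη1)
  have hscale : 0 ≤ noiseScale₁ τ ρ η d n := by unfold noiseScale₁; positivity
  have htwo : √2 ≤ 3 / 2 := Real.sqrt_le_iff.2 (by norm_num)
  calc noiseScale₁ τ ρ η d n * ((√d + √(Real.log (1 / η))) * √(Real.log (1 / η)))
      ≤ noiseScale₁ τ ρ η d n * (2 * (√d * Real.log (1 / η))) :=
        mul_le_mul_of_nonneg_left (add_sqrt_mul_sqrt_le (Nat.one_le_cast.2 hd) hlog) hscale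
    _ = 2 * (√2 * (τ * errorRate ρ η d n)) := by rw [← noiseScale₁_mul_sqrt_mul_log hd]; ring
    _ ≤ 2 * (3 / 2 * (τ * errorRate ρ η d n)) := by gcongr
    _ = 3 * (τ * errorRate ρ η d n) := by ring

lemma noiseLaw_not_noiseBounded_le (hd : 0 < d) (hn : 0 < n) (hτ : 0 < τ) (hρ : 0 < ρ)
    (hη : 0 < η) (hη1 : η < 1) :
    noiseLaw τ ρ η d n {w | ¬ NoiseBounded τ ρ η d n w} ≤ ENNReal.ofReal (2 * η + 2 * η) := by
  obtain ⟨hs₁, hs₂⟩ := noiseScale_pos hd hτ hρ hn hη hη1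
  exact measure_not_and_le (by positivity) (by positivity)
    ((measurePreserving_fst.measure_preimage_le _).trans
      (measure_opNorm_symMatrix_gt_le hs₁ hη hη1))
    ((measurePreserving_snd.measure_preimage_le _).trans (measure_norm_gt_le hs₂ hη hη1))

variable {w : (Fin d → Fin d → ℝ) × Vec d}

/-- The factor `√(log (1/η)) ≥ 216 τ` left over in `noiseScale₁_mul_add_sqrt_mul_sqrt_le` absorbs
the constants and `τ`. -/
lemma NoiseBounded.opNorm_symMatrix_le (h : NoiseBounded τ ρ η d n w) (hd : 0 < d) (hτ : 0 < τ)
    (hn : 0 < n) (hη : 0 < η) (hη1 : η < 1) (hlog : 1 + (216 * τ) ^ 2 ≤ Real.log (1 / η))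
    (hrate : errorRate ρ η d n ≤ 1 / 2) : opNorm (symMatrix w.1) ≤ 1 / 6 := by
  have hmul := noiseScale₁_mul_add_sqrt_mul_sqrt_le (ρ := ρ) hd hτ hn hη hη1
    (by linarith [sq_nonneg (216 * τ)])
  have hsqrt : 216 * τ ≤ √(Real.log (1 / η)) := Real.le_sqrt_of_sq_le (by linarith)
  have hpos : 0 < √(Real.log (1 / η)) := hsqrt.trans_lt' (by positivity)
  refine h.1.trans (le_of_mul_le_mul_right ?_ hpos)
  linarith [mul_le_mul_of_nonneg_left hrate hτ.le]

lemma NoiseBounded.norm_add_opNorm_le (h : NoiseBounded τ ρ η d n w) (hd : 0 < d) (hτ : 0 < τ)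
    (hn : 0 < n) (hη : 0 < η) (hη1 : η < 1) (hlog : 1 ≤ Real.log (1 / η)) :
    ‖w.2‖ + 3 * opNorm (symMatrix w.1) ≤ 234 * (τ * errorRate ρ η d n) := by
  have hl := one_add_log_pos hn hη hη1
  have hscale : 0 ≤ noiseScale₁ τ ρ η d n := by unfold noiseScale₁; positivity
  have hscale₁ : noiseScale₁ τ ρ η d n * (√d + √(Real.log (1 / η))) ≤
      3 * (τ * errorRate ρ η d n) := by
    refine (mul_le_mul_of_nonneg_left ?_ hscale).trans
      (noiseScale₁_mul_add_sqrt_mul_sqrt_le hd hτ hn hη hη1 hlog)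
    exact le_mul_of_one_le_right (by positivity) (Real.one_le_sqrt.2 hlog)
  have hscale₂ : noiseScale₂ τ ρ η d n * (√d + √(Real.log (1 / η))) ≤
      noiseScale₁ τ ρ η d n * (√d + √(Real.log (1 / η))) := by
    gcongr
    exact noiseScale₂_le_noiseScale₁ hτ hn hη hη1
  linarith [h.1, h.2]

end Noise

/-! ### Probability of the good events -/

/-- The constant `C` such that the empirical moments concentrate as soon as
`√n ≥ C (√d + √(log (1/η)))`. -/
def momentConst (K : ℝ) : ℝ :=
  max (2 / √(bernsteinRate (K ^ 2) (1 / 8))) (2 / √(bernsteinRate (4 * K ^ 2 + 16) (1 / 2)))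

lemma momentConst_pos {K : ℝ} (hK : 0 < K) : 0 < momentConst K :=
  lt_max_of_lt_left (div_pos two_pos (Real.sqrt_pos.2
    (bernsteinRate_pos (by positivity) (by norm_num))))

lemma four_mul_sq_le_of_two_div_sqrt_mul_le {c x y : ℝ} (hc : 0 < c) (hx : 0 ≤ x) (hy : 0 ≤ y)
    (h : 2 / √c * x ≤ √y) : 4 * x ^ 2 ≤ c * y :=
  calc 4 * x ^ 2 = c * (2 / √c * x) ^ 2 := by
        rw [mul_pow, div_pow, Real.sq_sqrt hc.le]; field_simp; ring
    _ ≤ c * √y ^ 2 := by gcongr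
    _ = c * y := by rw [Real.sq_sqrt hy]

section Events

variable {d n nA nB : ℕ} {ν : Measure (Vec d)} {S : Matrix (Fin d) (Fin d) ℝ} {K τ ρ η σ : ℝ}
  {β : Vec d}

lemma IsSubG.measure_not_close_le (hν : IsSubG ν S K) (hK : 0 < K) (hη : 0 < η) (hη1 : η < 1)
    (hv : 0 < responseVar S β σ) (hn : momentConst K * (√d + √(Real.log (1 / η))) ≤ √n) :
    Measure.pi (fun _ : Fin n => sampleLaw ν β σ)
      {D : Dataset n d | ¬ (MomentClose S D ∧ ResponseClose (responseVar S β σ) D)} ≤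
        ENNReal.ofReal (2 * η + 2 * η) := by
  have := hν.isProbabilityMeasure
  set x := √d + √(Real.log (1 / η))
  have hrate {b t : ℝ} (hb : 0 < b) (ht : 0 < t)
      (hle : 2 / √(bernsteinRate b t) ≤ momentConst K) :
      25 ^ d * Real.exp (-(bernsteinRate b t * n)) ≤ η :=
    pow_mul_exp_neg_le hη hη1 (four_mul_sq_le_of_two_div_sqrt_mul_le (bernsteinRate_pos hb ht)
      (by positivity) (by positivity) (hn.trans' (by gcongr)))
  refine measure_not_and_le (by positivity) (by positivity)
    ((hν.measure_not_momentClose_le hK (measurePreserving_fst_sampleLaw ν β σ) n).trans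
      (ENNReal.ofReal_le_ofReal ?_))
    ((hν.measure_not_responseClose_le hK β σ hv n).trans (ENNReal.ofReal_le_ofReal ?_))
  · linarith [hrate (b := K ^ 2) (t := 1 / 8) (by positivity) (by norm_num) (le_max_left _ _)]
  · have hdim : (1 : ℝ) ≤ 25 ^ d := one_le_pow₀ (by norm_num)
    linarith [hrate (b := 4 * K ^ 2 + 16) (t := 1 / 2) (by positivity) (by norm_num)
      (le_max_right _ _), le_mul_of_one_le_left (Real.exp_nonneg
        (-(bernsteinRate (4 * K ^ 2 + 16) (1 / 2) * n))) hdim]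

instance isProbabilityMeasure_dataLaw [IsProbabilityMeasure ν] :
    IsProbabilityMeasure (dataLaw nA nB ν β σ) := by
  unfold dataLaw
  infer_instance

lemma mul_add_sqrt_log_le {C : ℝ} (hC : 0 ≤ C) (hη : 0 < η) (hη1 : η < 1)
    (h : C * (√d + √(2 * Real.log (1 / η))) ≤ √n) : C * (√d + √(Real.log (1 / η))) ≤ √n := by
  have hlog : 0 ≤ Real.log (1 / η) := Real.log_nonneg (one_le_one_div hη hη1.le)
  refine h.trans' ?_
  gcongr
  linarith

theorem IsSubG.measure_not_noTruncationLoss_le (hν : IsSubG ν S K) (hK : 0 < K) (hdA : d < nA)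
    (hτ : 4 * (4 * K ^ 2 + 16) ≤ τ) (hη : 0 < η) (hη1 : η < 1) (hβσ : β ≠ 0 ∨ σ ≠ 0)
    (hnB : momentConst K * (√d + √(2 * Real.log (1 / η))) ≤ √nB) :
    dataLaw nA nB ν β σ {ω | ¬ NoTruncationLoss τ η ω.2 ω.1} ≤ ENNReal.ofReal (5 * η) := by
  have := hν.isProbabilityMeasure
  have hv := hν.responseVar_pos hβσ
  have hB := hν.measure_not_close_le hK hη hη1 hv
    (mul_add_sqrt_log_le (momentConst_pos hK).le hη hη1 hnB)
  have hA := hν.measure_not_sampleBounded_le hK β σ hv hdA hη hη1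
  rw [show 5 * η = 2 * η + 2 * η + η by ring]
  have hdata := measure_not_and_le (by positivity) hη.le
    ((measurePreserving_snd.measure_preimage_le _).trans hB)
    ((measurePreserving_fst.measure_preimage_le _).trans hA)
  refine hdata.trans' (measure_mono fun ω hω hgood => hω ?_)
  exact noTruncationLoss_of_close hν.posDef hv (by omega) hη hη1 hτ hgood.1.1 hgood.1.2 hgood.2

end Events

/-! ### Accuracy -/

lemma lowerEig_pos_le_one {C : ℝ} (hC : 0 ≤ C) (d : ℕ) {n : ℕ} (hn : 0 < n) (η : ℝ) :
    0 < lowerEig C d n η ∧ lowerEig C d n η ≤ 1 := by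
  have hn0 : (0 : ℝ) < n := by exact_mod_cast hn
  have hle : (n : ℝ) ≤ (√n + C * (√d + √(2 * Real.log (1 / η)))) ^ 2 :=
    calc (n : ℝ) = √n ^ 2 := (Real.sq_sqrt hn0.le).symm
      _ ≤ _ := by gcongr; exact le_add_of_nonneg_right (by positivity)
  exact ⟨div_pos hn0 (hn0.trans_le hle), div_le_one_of_le₀ hle (by positivity)⟩

lemma shrink_le_one {C : ℝ} (hC : 0 ≤ C) (d n : ℕ) (η : ℝ) : shrink C d n η ≤ 1 :=
  sub_le_self _ (by positivity)

lemma mul_le_sqrt_of_shrink_pos {C η : ℝ} {d n : ℕ} (hn : 0 < n) (h : 0 < shrink C d n η) :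
    C * (√d + √(Real.log (1 / η))) ≤ √n := by
  have hn0 : (0 : ℝ) < √n := Real.sqrt_pos.2 (by exact_mod_cast hn)
  rw [shrink, ← mul_div_assoc, sub_pos, div_lt_one hn0] at h
  exact h.le

/-- The event on which the released estimators are accurate: all matrices to be inverted are
invertible, and both error bounds hold, with `L` and `q` the factors `lowerEig` and `shrink`. -/
def AccurateRelease (C L q τ ρ η : ℝ) {nA nB d : ℕ} (β : Vec d) (pub : Dataset nB d)
    (priv : Dataset nA d) (w : (Fin d → Fin d → ℝ) × Vec d) : Prop :=
  (secondMoment pub).PosDef ∧ 0 < responseScale pub ∧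
    (secondMoment priv).PosDef ∧ IsUnit (noisyMoment τ η pub priv w).det ∧
    ‖dpTransformed τ η pub priv w - transformedOLS pub priv‖ ≤
      C * ((d : ℝ) ^ (3 / 2 : ℝ) * ‖β‖ * opNorm (secondMoment priv) *
          opNorm (invSqrt (secondMoment pub)) * Real.log (1 / η) /
        (responseScale pub * √ρ * nA * q ^ 4) *
        ((1 + Real.log (2 * nA / η)) / L ^ 2)) ∧
    ‖dpRecovered τ η pub priv w - ols priv‖ ≤
      C * ((d : ℝ) ^ (3 / 2 : ℝ) * ‖β‖ * opNorm (secondMoment priv) *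
          opNorm (secondMoment pub)⁻¹ * Real.log (1 / η) /
        (√ρ * nA * q ^ 4) *
        ((1 + Real.log (2 * nA / η)) / L ^ 2))

section Accuracy

variable {nA nB d : ℕ} {S : Matrix (Fin d) (Fin d) ℝ} {β : Vec d} {pub : Dataset nB d}
  {priv : Dataset nA d} {w : (Fin d → Fin d → ℝ) × Vec d} {C L q τ ρ η σ s : ℝ}

lemma accurateRelease_of_norm_sub_le (hB : (secondMoment pub).PosDef) (hpub : 0 < responseScale pub)
    (hA : (secondMoment priv).PosDef) (hdet : IsUnit (noisyMoment τ η pub priv w).det)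
    (h : ‖dpTransformed τ η pub priv w - transformedOLS pub priv‖ ≤
      C * (errorRate ρ η d nA / (q ^ 4 * L ^ 2) * (‖β‖ * opNorm (secondMoment priv) *
        opNorm (invSqrt (secondMoment pub)) / responseScale pub))) :
    AccurateRelease C L q τ ρ η β pub priv w := by
  refine ⟨hB, hpub, hA, hdet, h.trans_eq (by rw [errorRate]; ring), ?_⟩
  have hp := opNorm_nonneg (invSqrt (secondMoment pub))
  rw [← opNorm_invSqrt_sq hB]
  set a := opNorm (secondMoment priv)
  set p := opNorm (invSqrt (secondMoment pub))
  set r := responseScale pub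
  calc ‖dpRecovered τ η pub priv w - ols priv‖
      ≤ r * (p * ‖dpTransformed τ η pub priv w - transformedOLS pub priv‖) :=
        norm_dpRecovered_sub_le hB hpub w
    _ ≤ r * (p * (C * (errorRate ρ η d nA / (q ^ 4 * L ^ 2) * (‖β‖ * a * p / r)))) := by gcongr
    _ = C * (errorRate ρ η d nA / (q ^ 4 * L ^ 2) * (‖β‖ * a * p ^ 2)) * (r / r) := by ring
    _ = _ := by rw [div_self hpub.ne', errorRate]; ring

theorem accurateRelease_of_close (hS : S.PosDef) (hd : 0 < d) (hn : 0 < nA) (hτ : 0 < τ)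
    (hη : 0 < η) (hη1 : η < 1) (hlog : 1 + (216 * τ) ^ 2 ≤ Real.log (1 / η)) (hβ : β ≠ 0)
    (hσ0 : 0 ≤ σ) (hs : 0 ≤ s) (hσ : σ ≤ s * (√(opNorm S) * ‖β‖)) (hL0 : 0 < L) (hL1 : L ≤ 1)
    (hq0 : 0 < q) (hq1 : q ≤ 1)
    (hsmall : (d : ℝ) ^ (3 / 2 : ℝ) * (1 + Real.log (2 * nA / η)) * Real.log (1 / η) /
      (√ρ * nA * L * q ^ 2) ≤ 1 / 2)
    (hT : NoTruncationLoss τ η pub priv) (hB : MomentClose S pub)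
    (hRB : ResponseClose (responseVar S β σ) pub) (hA : MomentClose S priv)
    (hRA : ResponseClose (responseVar S β σ) priv) (hw : NoiseBounded τ ρ η d nA w) :
    AccurateRelease (4212 * τ * (1 + s)) L q τ ρ η β pub priv w := by
  have hX := errorRate_nonneg (ρ := ρ) (d := d) hn hη hη1
  have hrate : errorRate ρ η d nA ≤ 1 / 2 := by
    refine (le_div_self hX (by positivity : 0 < L * q ^ 2)
      (mul_le_one₀ hL1 (by positivity) (pow_le_one₀ hq0.le hq1))).trans (hsmall.trans_eq' ?_)
    rw [errorRate, div_div, ← mul_assoc]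
  have hG := hw.opNorm_symMatrix_le hd hτ hn hη hη1 hlog hrate
  obtain ⟨hdet, hdiff⟩ :=
    isUnit_det_noisyMoment_and_norm_dpTransformed_sub_le hS hA hB hRA hRB hT hG
  refine accurateRelease_of_norm_sub_le hT.1 hT.2.1 (hA.posDef hS) hdet ?_
  have hnoise := hw.norm_add_opNorm_le hd hτ hn hη hη1 (by linarith [sq_nonneg (216 * τ)])
  have hscale := one_le_mul_signalScale hs hS hβ hσ0 hσ hA hB hRB hT.2.1
  have hfactor : errorRate ρ η d nA ≤ errorRate ρ η d nA / (q ^ 4 * L ^ 2) :=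
    le_div_self hX (by positivity)
      (mul_le_one₀ (pow_le_one₀ hq0.le hq1) (by positivity) (pow_le_one₀ hL0.le hL1))
  set Z := ‖β‖ * opNorm (secondMoment priv) * opNorm (invSqrt (secondMoment pub)) /
    responseScale pub
  calc ‖dpTransformed τ η pub priv w - transformedOLS pub priv‖
      ≤ 1404 * τ * errorRate ρ η d nA * 1 := by linarith
    _ ≤ 1404 * τ * (errorRate ρ η d nA / (q ^ 4 * L ^ 2)) * (3 * (1 + s) * Z) := by gcongr
    _ = 4212 * τ * (1 + s) * (errorRate ρ η d nA / (q ^ 4 * L ^ 2) * Z) := by ring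

lemma one_le_exp_mul_of_log_le {a : ℝ} (hη : 0 < η) (h : Real.log (1 / η) ≤ a) :
    1 ≤ Real.exp a * η := by
  rwa [Real.log_le_iff_le_exp (by positivity), div_le_iff₀ hη] at h

variable {ν : Measure (Vec d)} {K : ℝ}

theorem IsSubG.measure_not_accurateRelease_le (hν : IsSubG ν S K) (hK : 0 < K) (hd : 0 < d)
    (hdA : d < nA) (hdB : d < nB) (hρ : 0 < ρ) (hτ : 4 * (4 * K ^ 2 + 16) ≤ τ) (hη : 0 < η)
    (hη1 : η < 1) (hβ : β ≠ 0) (hσ0 : 0 ≤ σ) (hs : 0 ≤ s)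
    (hσ : σ ≤ s * (√(opNorm S) * ‖β‖))
    (hnB : momentConst K * (√d + √(2 * Real.log (1 / η))) ≤ √nB)
    (hC : 0 ≤ C) (hq : 0 < shrink (momentConst K) d nA η)
    (hsmall : (d : ℝ) ^ (3 / 2 : ℝ) * (1 + Real.log (2 * nA / η)) * Real.log (1 / η) /
      (√ρ * nA * lowerEig C d nB η * shrink (momentConst K) d nA η ^ 2) ≤ 1 / 2) :
    ((dataLaw nA nB ν β σ).prod (noiseLaw τ ρ η d nA))
      {ω | ¬ AccurateRelease (4212 * τ * (1 + s)) (lowerEig C d nB η)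
        (shrink (momentConst K) d nA η) τ ρ η β ω.1.2 ω.1.1 ω.2} ≤
      ENNReal.ofReal ((Real.exp (1 + (216 * τ) ^ 2) + 17) * η) := by
  have := hν.isProbabilityMeasure
  -- For `log (1/η) < 1 + (216 τ) ^ 2` the asserted bound exceeds `1`.
  rcases lt_or_ge (Real.log (1 / η)) (1 + (216 * τ) ^ 2) with hlog | hlog
  · refine prob_le_one.trans (ENNReal.one_le_ofReal.2 ?_)
    linarith [one_le_exp_mul_of_log_le hη hlog.le]
  have hτ0 : 0 < τ := hτ.trans_lt' (by positivity)
  have hn : 0 < nA := by omega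
  have hC₀ := (momentConst_pos hK).le
  have hv := hν.responseVar_pos (σ := σ) (Or.inl hβ)
  have hA := hν.measure_not_close_le hK hη hη1 hv (mul_le_sqrt_of_shrink_pos hn hq)
  have hB := hν.measure_not_close_le hK hη hη1 hv (mul_add_sqrt_log_le hC₀ hη hη1 hnB)
  have hT := hν.measure_not_noTruncationLoss_le hK hdA hτ hη hη1 (σ := σ) (Or.inl hβ) hnB
  have hdata := measure_not_and_le (by positivity) (by positivity)
    (measure_not_and_le (by positivity) (by positivity)
      ((measurePreserving_fst.measure_preimage_le _).trans hA)
      ((measurePreserving_snd.measure_preimage_le _).trans hB)) hT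
  have hall := measure_not_and_le (by positivity) (by positivity)
    ((measurePreserving_fst.measure_preimage_le _).trans hdata)
    ((measurePreserving_snd.measure_preimage_le _).trans
      (noiseLaw_not_noiseBounded_le hd hn hτ0 hρ hη hη1))
  obtain ⟨hL0, hL1⟩ := lowerEig_pos_le_one hC d (hd.trans hdB) η
  refine (hall.trans (ENNReal.ofReal_le_ofReal ?_)).trans'
    (measure_mono fun ω hω hgood => hω ?_)
  · linarith [mul_pos (Real.exp_pos (1 + (216 * τ) ^ 2)) hη]
  · obtain ⟨⟨⟨hclA, hclB⟩, hTr⟩, hw⟩ := hgood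
    exact accurateRelease_of_close hν.posDef hd hn hτ0 hη hη1 hlog hβ hσ0 hs hσ hL0 hL1 hq
      (shrink_le_one hC₀ d nA η) hsmall hTr hclB.1 hclB.2 hclA.1 hclA.2 hw

end Accuracy

end DPOLS

end

open DPOLS in
theorem mainTheorem1 :
    -- privacy
    (∀ (d nA nB : ℕ) (τ ρ η : ℝ), 0 < d → 0 < τ → 0 < ρ → 0 < η → η < 1 →
      ∀ pub : Dataset nB d,
        IsZCDP (fun priv : Dataset nA d => dpPMTOLSE τ ρ η pub priv) (2 * ρ)) ∧
    -- utility: the constants depend on the sub-Gaussian norm `K` alone, ...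
    ∀ K : ℝ, 0 < K →
      ∃ τ₀ : ℝ, 0 < τ₀ ∧ ∃ C₁ : ℝ, 0 < C₁ ∧ ∃ C₂ : ℝ, 0 < C₂ ∧ ∃ C₃ : ℝ, 0 < C₃ ∧
      ∃ c₁ : ℝ, 0 < c₁ ∧
      -- no truncation loss
      (∀ (d nA nB : ℕ) (τ η σ : ℝ) (ν : Measure (Vec d)) (S : Matrix (Fin d) (Fin d) ℝ)
        (β : Vec d),
        0 < d → d < nA → d < nB → τ₀ ≤ τ → 0 < η → η < 1 → 0 ≤ σ → IsSubG ν S K →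
        (β ≠ 0 ∨ σ ≠ 0) →
        C₁ * (√d + √(2 * Real.log (1 / η))) ≤ √nB →
        dataLaw nA nB ν β σ {ω | ¬ NoTruncationLoss τ η ω.2 ω.1} ≤ ENNReal.ofReal (c₁ * η)) ∧
      -- accuracy: ... except that `c₂` may depend on `τ`, and `C` on `τ` and on the bound `s`
      -- for the noise-to-signal ratio
      (∀ τ : ℝ, τ₀ ≤ τ → ∃ c₂ : ℝ, 0 < c₂ ∧ ∀ s : ℝ, 0 < s → ∃ C : ℝ, 0 < C ∧
        ∀ (d nA nB : ℕ) (ρ η σ : ℝ) (ν : Measure (Vec d)) (S : Matrix (Fin d) (Fin d) ℝ)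
          (β : Vec d),
          0 < d → d < nA → d < nB → 0 < ρ → 0 < η → η < 1 → 0 ≤ σ → IsSubG ν S K →
          β ≠ 0 → σ ≤ s * (√(opNorm S) * ‖β‖) →
          C₁ * (√d + √(2 * Real.log (1 / η))) ≤ √nB →
          0 < shrink C₃ d nA η →
          (d : ℝ) ^ (3 / 2 : ℝ) * (1 + Real.log (2 * nA / η)) * Real.log (1 / η) /
            (√ρ * nA * lowerEig C₂ d nB η * shrink C₃ d nA η ^ 2) ≤ 1 / 2 →
          ((dataLaw nA nB ν β σ).prod (noiseLaw τ ρ η d nA))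
            {ω | ¬ ((secondMoment ω.1.2).PosDef ∧ 0 < responseScale ω.1.2 ∧
              (secondMoment ω.1.1).PosDef ∧ IsUnit (noisyMoment τ η ω.1.2 ω.1.1 ω.2).det ∧
              ‖dpTransformed τ η ω.1.2 ω.1.1 ω.2 - transformedOLS ω.1.2 ω.1.1‖ ≤
                C * ((d : ℝ) ^ (3 / 2 : ℝ) * ‖β‖ * opNorm (secondMoment ω.1.1) *
                    opNorm (invSqrt (secondMoment ω.1.2)) * Real.log (1 / η) /
                  (responseScale ω.1.2 * √ρ * nA * shrink C₃ d nA η ^ 4) *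
                  ((1 + Real.log (2 * nA / η)) / lowerEig C₂ d nB η ^ 2)) ∧
              ‖dpRecovered τ η ω.1.2 ω.1.1 ω.2 - ols ω.1.1‖ ≤
                C * ((d : ℝ) ^ (3 / 2 : ℝ) * ‖β‖ * opNorm (secondMoment ω.1.1) *
                    opNorm (secondMoment ω.1.2)⁻¹ * Real.log (1 / η) /
                  (√ρ * nA * shrink C₃ d nA η ^ 4) *
                  ((1 + Real.log (2 * nA / η)) / lowerEig C₂ d nB η ^ 2)))} ≤
            ENNReal.ofReal (c₂ * η)) := by
  refine ⟨isZCDP_dpPMTOLSE, fun K hK => ⟨4 * (4 * K ^ 2 + 16), by positivity,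
    momentConst K, momentConst_pos hK, 1, one_pos, momentConst K, momentConst_pos hK,
    5, by norm_num, ?noTruncationLoss,
    fun τ hτ => ⟨Real.exp (1 + (216 * τ) ^ 2) + 17, by positivity, fun s hs =>
      ⟨4212 * τ * (1 + s), ?constPos, ?accuracy⟩⟩⟩⟩
  case noTruncationLoss =>
    intro d nA nB τ η σ ν S β _ hdA _ hτ hη hη1 _ hν hβσ hnB
    exact hν.measure_not_noTruncationLoss_le hK hdA hτ hη hη1 hβσ hnB
  case constPos =>
    have hτ0 : 0 < τ := hτ.trans_lt' (by positivity)
    positivity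
  case accuracy =>
    intro d nA nB ρ η σ ν S β hd hdA hdB hρ hη hη1 hσ0 hν hβ hσ hnB hq hsmall
    exact hν.measure_not_accurateRelease_le hK hd hdA hdB hρ hτ hη hη1 hβ hσ0 hs.le hσ hnB
      zero_le_one hq hsmall
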